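/- **Model.** Let $n\ge 2$, $p\ge 1$, $\sigma>0$, and let $X_1,\dots,X_n$ be independent with $X_v\sim \mathrm N_p(\mu_v,\sigma^2 I)$. Suppose that there are $J\ge 0$ changepoints $0=\eta_0<\eta_1<\dots<\eta_J<\eta_{J+1}=n$, i.e. for $1\le v<n$, $\mu_v\ne\mu_{v+1}$ if and only if $v=\eta_j$ for some $1\le j\le J$. Put $\theta_j=\mu_{\eta_{j+1}}-\mu_{\eta_j}$, $\phi_j=\|\theta_j\|_2$, $k_j=\|\theta_j\|_0$ (number of nonzero entries), $\Delta_j=\min(\eta_j-\eta_{j-1},\eta_{j+1}-\eta_j)$, and $$r(t)=\begin{cases}\sqrt{p\log n}& t\ge\sqrt{p\log n},\\ \max\{t\log(ep\log n/t^2),\ \log n\}&\text{otherwise.}\end{cases}$$ **Scores.** For $0\le s<v<e\le n$ let $C^v_{(s,e]}(i)=\sqrt{\tfrac{e-v}{(e-s)(v-s)}}\sum_{t=s+1}^v x_{i,t}-\sqrt{\tfrac{v-s}{(e-s)(e-v)}}\sum_{t=v+1}^e x_{i,t}$ for the rescaled data $x=X/\sigma$. Let $a(t)\ge 0$ be given by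 $a^2(t)=4\log(ep\log n/t^2)$ if $t\le\sqrt{p\log n}$ and $a(t)=0$ otherwise, let $\nu_a=E(Z^2\mid |Z|\ge a)$ for $Z\sim \mathrm N(0,1)$, let $\mathcal T=\{1,2,4,\dots,2^{\lfloor\log_2\lfloor\sqrt{p\log n}\rfloor\rfloor}\}\cup\{p\}$ (just $\{1\}$ if $p\log n<1$), and for a penalty function $\gamma$ put $$S^v_{\gamma,(s,e]}=\max_{t\in\mathcal T}\Big[\sum_{i=1}^p\{C^v_{(s,e]}(i)^2-\nu_{a(t)}\}\mathbf 1\{|C^v_{(s,e]}(i)|\ge a(t)\}-\gamma(t)\Big].$$ **Seeded intervals.** For real $1<\alpha\le 2$, $K\ge 2$, let $l_1=1$, $l_{m+1}=\max\{l_m+1,\lfloor\alpha l_m\rfloor\}$. The collection $\mathcal M$ consists, for every $l=l_m\le n/2$ and with $d=\max\{1,\lfloor l/K\rfloor\}$, of the intervals $(id,id+2l]$, $0\le i\le (n-2l)/d$, and of $(n-2l,n]$. **ESAC.** Given penalty functions $\gamma,\lambda$, the procedure run on $(s,e]$ stops if $e-s\le1$. Otherwise it collects all $(s_m,e_m]\in\mathcal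 M$ contained in $(s,e]$ in which a changepoint is detected, meaning $\max_{s_m<v<e_m}S^v_{\gamma,(s_m,e_m]}>0$ in the standard version and $S^{\lfloor (s_m+e_m)/2\rfloor}_{\gamma,(s_m,e_m]}>0$ in the fast (midpoint) version. If there is none, it stops. Otherwise, among the detecting intervals of minimal width it chooses an interval $(s^*,e^*]$ and a position $s^*<v^*<e^*$ that maximise $S^v_{\lambda,(s_m,e_m]}$ (ties broken arbitrarily), declares $v^*$ a changepoint, and continues recursively on $(s,s^*+1]$ and $(e^*-1,e]$. It is started on $(0,n]$; let $\widehat J$ be the number of declared changepoints and $\widehat\eta_1<\dots<\widehat\eta_{\widehat J}$ their positions. **Theorem.** There are universal constants $\gamma_0,C_0,C_1>0$ ($C_0,C_1$ depending only on $\gamma_0$) such that for either version of ESAC, with $\gamma(t)=\gamma_0r(t)$, for any $n,p,\sigma,\alpha,K$, means and changepoints as above and any penalty function $\lambda$: if $$\frac{\phi_j^2\Delta_j}{\sigma^2}\ge C_0\,r(k_j)\qquad\text{for all }1\le j\le J,$$ then $$\mathbb P\Big\{\widehat J=J\ \text{ and }\ |\widehat\eta_j-\eta_j|\le C_1\frac{\sigma^2}{\phi_j^2}\,r(k_j)\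 \text{ for all }1\le j\le J\Big\}>1-\frac1n .$$ -/

import Mathlib

/-! Data are indexed by times `1, …, n`; a data matrix is a function sending a time `v : ℕ` to its
column in `ℝ^p`, of which only the columns `v ∈ {1, …, n}` are ever used.  A pair `I : ℕ × ℕ` stands
for the integer interval `(I.1, I.2] = {I.1 + 1, …, I.2}`. -/

namespace ESAC

open MeasureTheory ProbabilityTheory

/-! ### Changepoints -/

/-- `0 = η 0 < η 1 < … < η J < η (J + 1) = n`, and `η 1, …, η J` are exactly the times at which the
mean sequence `μ 1, …, μ n` changes. -/
structure IsChangepointSequence {p : ℕ} (n J : ℕ) (μ : ℕ → EuclideanSpace ℝ (Fin p))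
    (η : ℕ → ℕ) : Prop where
  zero : η 0 = 0
  last : η (J + 1) = n
  strict : ∀ j ≤ J, η j < η (j + 1)
  change_iff : ∀ v, 1 ≤ v → v < n → (μ v ≠ μ (v + 1) ↔ ∃ j, 1 ≤ j ∧ j ≤ J ∧ v = η j)

/-- The change in mean at the `j`th changepoint. -/
noncomputable def meanChange {p : ℕ} (μ : ℕ → EuclideanSpace ℝ (Fin p)) (η : ℕ → ℕ) (j : ℕ) :
    EuclideanSpace ℝ (Fin p) :=
  μ (η (j + 1)) - μ (η j)

/-- Number of nonzero coordinates of a vector. -/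
noncomputable def sparsity {p : ℕ} (θ : EuclideanSpace ℝ (Fin p)) : ℕ :=
  {i : Fin p | θ i ≠ 0}.ncard

/-- Distance from the `j`th changepoint (`1 ≤ j ≤ J`) to its nearest neighbour. -/
noncomputable def spacing (η : ℕ → ℕ) (j : ℕ) : ℝ :=
  min ((η j : ℝ) - η (j - 1)) ((η (j + 1) : ℝ) - η j)

/-! ### Penalised scores -/

/-- The rate `r(t) = r(t, n, p)`. -/
noncomputable def rate (n p t : ℕ) : ℝ :=
  if √(p * Real.log n) ≤ t then √(p * Real.log n)
  else max (t * Real.log (Real.exp 1 * p * Real.log n / (t : ℝ) ^ 2)) (Real.log n)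

/-- The threshold `a(t)`. -/
noncomputable def threshold (n p t : ℕ) : ℝ :=
  if (t : ℝ) ≤ √(p * Real.log n) then
    √(4 * Real.log (Real.exp 1 * p * Real.log n / (t : ℝ) ^ 2))
  else 0

/-- `ν_a = E(Z² | |Z| ≥ a)` for `Z ∼ N(0, 1)`. -/
noncomputable def truncatedSecondMoment (a : ℝ) : ℝ :=
  ∫ z, z ^ 2 ∂(ProbabilityTheory.cond (gaussianReal 0 1) {z | a ≤ |z|})

/-- The grid of candidate sparsities `{1, 2, 4, …, 2 ^ ⌊log₂ ⌊√(p log n)⌋⌋} ∪ {p}`. -/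
noncomputable def sparsityGrid (n p : ℕ) : Finset ℕ :=
  insert p ((Finset.range (Nat.log 2 ⌊√(p * Real.log n)⌋₊ + 1)).image (fun i => 2 ^ i))

/-- The CUSUM transformation `T^v_{(s,e]}(y)`, for `s < v < e`. -/
noncomputable def cusum (s e v : ℕ) (y : ℕ → ℝ) : ℝ :=
  √(((e : ℝ) - v) / (((e : ℝ) - s) * ((v : ℝ) - s))) * ∑ t ∈ Finset.Ioc s v, y t
    - √(((v : ℝ) - s) / (((e : ℝ) - s) * ((e : ℝ) - v))) * ∑ t ∈ Finset.Ioc v e, y t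

open Classical in
/-- The sparsity-specific penalised score `S^v_{γ,(s,e]}(t)` of the data `x`, with penalty `γ`. -/
noncomputable def sparsityScore {p : ℕ} (n : ℕ) (x : ℕ → EuclideanSpace ℝ (Fin p)) (γ : ℕ → ℝ)
    (s e v t : ℕ) : ℝ :=
  (∑ i : Fin p,
    if threshold n p t ≤ |cusum s e v (fun u => x u i)| then
      cusum s e v (fun u => x u i) ^ 2 - truncatedSecondMoment (threshold n p t)
    else 0) - γ t

/-- The penalised score `S^v_{γ,(s,e]}`, the maximum of the sparsity-specific scores over the
grid of candidate sparsities. -/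
noncomputable def score {p : ℕ} (n : ℕ) (x : ℕ → EuclideanSpace ℝ (Fin p)) (γ : ℕ → ℝ)
    (s e v : ℕ) : ℝ :=
  (sparsityGrid n p).sup' (Finset.insert_nonempty _ _) (sparsityScore n x γ s e v)

/-! ### Seeded intervals -/

/-- The successive half-lengths `1 = l₀ < l₁ < …`, `l_{j+1} = max {l_j + 1, ⌊α l_j⌋}`. -/
noncomputable def seedLength (α : ℝ) : ℕ → ℕ
  | 0 => 1
  | j + 1 => max (seedLength α j + 1) ⌊α * seedLength α j⌋₊

/-- The shift `max {1, ⌊l / K⌋}` between consecutive seeded intervals of half-length `l`. -/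
noncomputable def seedShift (K : ℝ) (l : ℕ) : ℕ := max 1 ⌊(l : ℝ) / K⌋₊

/-- The set of seeded intervals: for every half-length `l = l_j ≤ n / 2` with shift `s`, the
intervals `(i s, i s + 2 l]` for `i = 0, …, ⌊(n - 2 l) / s⌋`, and the interval `(n - 2 l, n]`. -/
def seededIntervals (n : ℕ) (α K : ℝ) : Set (ℕ × ℕ) :=
  {I | ∃ j l s : ℕ, l = seedLength α j ∧ s = seedShift K l ∧ 2 * l ≤ n ∧
    ((∃ i, i ≤ (n - 2 * l) / s ∧ I = (i * s, i * s + 2 * l)) ∨ I = (n - 2 * l, n))}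

/-! ### The search procedure -/

/-- The two versions of the procedure, which differ in the positions at which a seeded interval is
tested for a changepoint: all interior positions, or the midpoint only. -/
inductive Variant
  | full
  | midpoint

/-- A changepoint is detected in the interval `I`, using the detection penalty `γ`. -/
def Detects {p : ℕ} (variant : Variant) (n : ℕ) (x : ℕ → EuclideanSpace ℝ (Fin p)) (γ : ℕ → ℝ)
    (I : ℕ × ℕ) : Prop :=
  match variant with
  | .full => ∃ v, I.1 < v ∧ v < I.2 ∧ 0 < score n x γ I.1 I.2 v
  | .midpoint => 0 < score n x γ I.1 I.2 ((I.1 + I.2) / 2)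

/-- The intervals of `M` contained in `(s, e]` in which a changepoint is detected. -/
def detections {p : ℕ} (variant : Variant) (n : ℕ) (x : ℕ → EuclideanSpace ℝ (Fin p))
    (M : Set (ℕ × ℕ)) (γ : ℕ → ℝ) (s e : ℕ) : Set (ℕ × ℕ) :=
  {I | I ∈ M ∧ s ≤ I.1 ∧ I.2 ≤ e ∧ Detects variant n x γ I}

/-- The intervals of minimal width among the detections. -/
def narrowestDetections {p : ℕ} (variant : Variant) (n : ℕ) (x : ℕ → EuclideanSpace ℝ (Fin p))
    (M : Set (ℕ × ℕ)) (γ : ℕ → ℝ) (s e : ℕ) : Set (ℕ × ℕ) :=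
  {I | I ∈ detections variant n x M γ s e ∧
    ∀ I' ∈ detections variant n x M γ s e, I.2 - I.1 ≤ I'.2 - I'.1}

/-- `Run variant n x M γ lam s e B`: the recursive procedure, called on the interval `(s, e]` with
intervals `M`, detection penalty `γ` and estimation penalty `lam`, can return `B` as the set of
changepoints that it declares in this call and in the recursive calls that this call makes.
A declared changepoint `v` lies in a narrowest detection `I`, and `(I, v)` maximises the score with
penalty `lam` over the narrowest detections and all their interior positions; ties may be broken in
any way.  The recursive calls are on `(s, I.1 + 1]` and `(I.2 - 1, e]`. -/
inductive Run {p : ℕ} (variant : Variant) (n : ℕ) (x : ℕ → EuclideanSpace ℝ (Fin p))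
    (M : Set (ℕ × ℕ)) (γ lam : ℕ → ℝ) : ℕ → ℕ → Finset ℕ → Prop
  | short (s e : ℕ) : e ≤ s + 1 → Run variant n x M γ lam s e ∅
  | none (s e : ℕ) : s + 1 < e → detections variant n x M γ s e = ∅ →
      Run variant n x M γ lam s e ∅
  | declare (s e : ℕ) (I : ℕ × ℕ) (v : ℕ) (B₁ B₂ : Finset ℕ) : s + 1 < e →
      I ∈ narrowestDetections variant n x M γ s e → I.1 < v → v < I.2 →
      (∀ I' ∈ narrowestDetections variant n x M γ s e, ∀ v', I'.1 < v' → v' < I'.2 →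
        score n x lam I'.1 I'.2 v' ≤ score n x lam I.1 I.2 v) →
      Run variant n x M γ lam s (I.1 + 1) B₁ →
      Run variant n x M γ lam (I.2 - 1) e B₂ →
      Run variant n x M γ lam s e ({v} ∪ B₁ ∪ B₂)

/-- `B` is a possible output (set of estimated changepoints) of the whole procedure on the data `x`:
it is started on `(0, n]` with the seeded intervals with parameters `α` and `K`. -/
def IsOutput {p : ℕ} (variant : Variant) (n : ℕ) (α K : ℝ) (γ lam : ℕ → ℝ)
    (x : ℕ → EuclideanSpace ℝ (Fin p)) (B : Finset ℕ) : Prop :=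
  Run variant n x (seededIntervals n α K) γ lam 0 n B

/-! ### The procedure always has an output -/

theorem one_le_seedLength (α : ℝ) (j : ℕ) : 1 ≤ seedLength α j := by
  cases j with
  | zero => simp [seedLength]
  | succ j => simp [seedLength]

theorem width_of_mem_seededIntervals {n : ℕ} {α K : ℝ} {I : ℕ × ℕ}
    (hI : I ∈ seededIntervals n α K) : I.1 + 2 ≤ I.2 := by
  obtain ⟨j, l, s, hl, -, hn, h⟩ := hI
  have h1 := one_le_seedLength α j
  rcases h with ⟨i, -, rfl⟩ | rfl <;> simp only <;> omega

theorem exists_run {p : ℕ} (variant : Variant) (n : ℕ) (x : ℕ → EuclideanSpace ℝ (Fin p))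
    (M : Set (ℕ × ℕ)) (hM : ∀ I ∈ M, I.1 + 2 ≤ I.2) (γ lam : ℕ → ℝ) (s e : ℕ) :
    ∃ B, Run variant n x M γ lam s e B := by
  induction hd : e - s using Nat.strong_induction_on generalizing s e with
  | _ d ih =>
    by_cases hse : e ≤ s + 1
    · exact ⟨∅, .short s e hse⟩
    rcases Set.eq_empty_or_nonempty (detections variant n x M γ s e) with h0 | hne
    · exact ⟨∅, .none s e (by omega) h0⟩
    let N : Set (ℕ × ℕ) := narrowestDetections variant n x M γ s e
    let Q : Set ((ℕ × ℕ) × ℕ) := {q | q.1 ∈ N ∧ q.1.1 < q.2 ∧ q.2 < q.1.2}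
    have hN : ∀ I ∈ N, s ≤ I.1 ∧ I.1 + 2 ≤ I.2 ∧ I.2 ≤ e := fun I hI =>
      ⟨hI.1.2.1, hM I hI.1.1, hI.1.2.2.1⟩
    have hQf : Q.Finite := by
      refine Set.Finite.subset (((Set.finite_Iic e).prod (Set.finite_Iic e)).prod
        (Set.finite_Iic e)) ?_
      rintro ⟨⟨a, b⟩, v⟩ ⟨h1, h2, h3⟩
      have := hN _ h1
      simp only at this h2 h3
      simp only [Set.mem_prod, Set.mem_Iic]
      omega
    obtain ⟨I₀, hI₀, hmin⟩ : ∃ I ∈ detections variant n x M γ s e,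
        ∀ I' ∈ detections variant n x M γ s e, I.2 - I.1 ≤ I'.2 - I'.1 := by
      obtain ⟨I, hI, h⟩ := (InvImage.wf (fun I : ℕ × ℕ => I.2 - I.1)
        Nat.lt_wfRel.wf).has_min _ hne
      exact ⟨I, hI, fun I' hI' => not_lt.mp (h I' hI')⟩
    have hQne : Q.Nonempty := by
      have := hM I₀ hI₀.1
      exact ⟨(I₀, I₀.1 + 1), ⟨hI₀, hmin⟩, by simp only; omega, by simp only; omega⟩
    obtain ⟨⟨I, v⟩, ⟨hI, hv1, hv2⟩, hmax⟩ :=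
      hQf.exists_maximalFor (fun q => score n x lam q.1.1 q.1.2 q.2) Q hQne
    have hmax' : ∀ I' ∈ N, ∀ v', I'.1 < v' → v' < I'.2 →
        score n x lam I'.1 I'.2 v' ≤ score n x lam I.1 I.2 v := by
      intro I' hI' v' h1 h2
      rcases le_total (score n x lam I'.1 I'.2 v') (score n x lam I.1 I.2 v) with h | h
      · exact h
      · exact hmax (j := (I', v')) ⟨hI', h1, h2⟩ h
    have hw := hN I hI
    obtain ⟨B₁, hB₁⟩ := ih (I.1 + 1 - s) (by omega) s (I.1 + 1) rfl
    obtain ⟨B₂, hB₂⟩ := ih (e - (I.2 - 1)) (by omega) (I.2 - 1) e rfl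
    exact ⟨_, .declare s e I v B₁ B₂ (by omega) hI hv1 hv2 hmax' hB₁ hB₂⟩

theorem exists_isOutput {p : ℕ} (variant : Variant) (n : ℕ) (α K : ℝ) (γ lam : ℕ → ℝ)
    (x : ℕ → EuclideanSpace ℝ (Fin p)) : ∃ B, IsOutput variant n α K γ lam x B :=
  exists_run variant n x _ (fun _ hI => width_of_mem_seededIntervals hI) γ lam 0 n

end ESAC

namespace ESAC

open MeasureTheory ProbabilityTheory

/-! ### Truncated squares of a standard Gaussian variable -/

/-! The randomness enters through two families of events. For every triple `s < v < e ≤ n` with no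
changepoint strictly between `s` and `e`, the score should be nonpositive; and each changepoint
should make the midpoint score positive on one seeded interval whose half-length is of order `σ²
r(k_j) / φ_j²`. Each event fails with probability at most `n⁻⁶`, and there are at most `n³ + n` of
them, so a union bound leaves less than `1/n`. On the good event the rest is deterministic.

Probability. The CUSUM weights have unit square sum, so a CUSUM vector is its mean plus a standard
Gaussian vector (`map_cusum_eq_pi`). The centred square truncated at `a` has cumulant generating
function at most `M l² exp(-a²/4)` for small `|l|` (`exists_mgf_truncatedSquare_le`). For `a = a(t)`
this, multiplied by `p`, is at most `M l² t² / log n` in the sparse regime, and a choice of `l` in a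
Chernoff bound gives tails at level `r(t)` (`exists_tail_bound`) that are summable over the dyadic
sparsity grid. For a signal of sparsity `k`, the grid point just below `k`, or `p` if `k` is large,
gives a positive score once the squared norm of the mean exceeds a multiple of `r(k)`
(`exists_score_constants`).

Recursion. Every detecting interval contains a changepoint. A narrowest detection is no wider than
the good interval of any changepoint available in the current segment, and these intervals are short
relative to the spacings. Hence it isolates exactly one changepoint, any interior position is within
its width of that changepoint, and the good intervals of the other changepoints survive in the two
recursive segments (`exists_image_of_run`). The argument never compares scores with penalty `λ`. -/

theorem integrable_exp_mul_sq {c : ℝ} (hc : c < 1 / 2) :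
    Integrable (fun z : ℝ => Real.exp (c * z ^ 2)) (gaussianReal 0 1) := by
  rw [gaussianReal_of_var_ne_zero _ one_ne_zero,
    integrable_withDensity_iff (measurable_gaussianPDF _ _) (by simp [gaussianPDF])]
  have : Integrable (fun x : ℝ => (√(2 * Real.pi))⁻¹ * Real.exp (-(1 / 2 - c) * x ^ 2)) :=
    (integrable_exp_neg_mul_sq (by linarith)).const_mul _
  refine this.congr (ae_of_all _ fun x => ?_)
  simp only [toReal_gaussianPDF, gaussianPDFReal]
  rw [mul_comm (Real.exp (c * x ^ 2)), mul_assoc, ← Real.exp_add]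
  simp only [NNReal.coe_one, mul_one]
  congr 2
  ring

theorem one_le_integral_exp_mul_sq {c : ℝ} (hc : c < 1 / 2) (h0 : 0 ≤ c) :
    1 ≤ ∫ z, Real.exp (c * z ^ 2) ∂(gaussianReal 0 1) := by
  calc (1 : ℝ) = ∫ _, (1 : ℝ) ∂(gaussianReal 0 1) := by simp
    _ ≤ _ := integral_mono (integrable_const _) (integrable_exp_mul_sq hc)
      fun z => Real.one_le_exp (by positivity)

theorem integrable_sq_gaussianReal : Integrable (fun z : ℝ => z ^ 2) (gaussianReal 0 1) := by
  refine (integrable_exp_mul_sq (c := 1 / 4) (by norm_num)).const_mul 4 |>.mono'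
    (by fun_prop) (ae_of_all _ fun z => ?_)
  rw [Real.norm_of_nonneg (sq_nonneg z)]
  have := Real.add_one_le_exp (1 / 4 * z ^ 2)
  linarith

theorem measurableSet_le_abs (a : ℝ) : MeasurableSet {z : ℝ | a ≤ |z|} :=
  measurableSet_le measurable_const measurable_abs

/-- The interval `[a, a + 1]` has unit length, and the density on it is smallest at its right end.
-/
theorem gaussianReal_le_abs_ge {a : ℝ} (ha : 0 ≤ a) :
    (√(2 * Real.pi))⁻¹ * Real.exp (-(a + 1) ^ 2 / 2) ≤ (gaussianReal 0 1).real {z | a ≤ |z|} := by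
  have h1 : (gaussianReal 0 1).real (Set.Icc a (a + 1)) ≤ (gaussianReal 0 1).real {z | a ≤ |z|} :=
    measureReal_mono fun z hz => hz.1.trans (le_abs_self z)
  refine le_trans ?_ h1
  rw [measureReal_def, gaussianReal_apply_eq_integral _ one_ne_zero, ENNReal.toReal_ofReal
    (integral_nonneg fun z => gaussianPDFReal_nonneg _ _ _)]
  have h2 : ∫ _ in Set.Icc a (a + 1), (√(2 * Real.pi))⁻¹ * Real.exp (-(a + 1) ^ 2 / 2) =
      (√(2 * Real.pi))⁻¹ * Real.exp (-(a + 1) ^ 2 / 2) := by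
    simp
  rw [← h2]
  refine setIntegral_mono_on (integrableOn_const (by simp))
    (integrable_gaussianPDFReal 0 1).integrableOn measurableSet_Icc fun z hz => ?_
  simp only [gaussianPDFReal, NNReal.coe_one, mul_one, sub_zero]
  have : z ^ 2 ≤ (a + 1) ^ 2 := pow_le_pow_left₀ (ha.trans hz.1) hz.2 2
  gcongr

theorem gaussianReal_le_abs_pos {a : ℝ} (ha : 0 ≤ a) :
    0 < (gaussianReal 0 1).real {z | a ≤ |z|} :=
  lt_of_lt_of_le (by positivity) (gaussianReal_le_abs_ge ha)

theorem truncatedSecondMoment_eq (a : ℝ) :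
    truncatedSecondMoment a = ((gaussianReal 0 1).real {z | a ≤ |z|})⁻¹ *
      ∫ z in {z | a ≤ |z|}, z ^ 2 ∂(gaussianReal 0 1) := by
  rw [truncatedSecondMoment, ProbabilityTheory.cond, integral_smul_measure, smul_eq_mul,
    ENNReal.toReal_inv, measureReal_def]

theorem truncatedSecondMoment_mul {a : ℝ} (ha : 0 ≤ a) :
    truncatedSecondMoment a * (gaussianReal 0 1).real {z | a ≤ |z|} =
      ∫ z in {z | a ≤ |z|}, z ^ 2 ∂(gaussianReal 0 1) := by
  have := gaussianReal_le_abs_pos ha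
  rw [truncatedSecondMoment_eq]
  field_simp

theorem truncatedSecondMoment_zero : truncatedSecondMoment 0 = 1 := by
  have h := variance_id_gaussianReal (μ := 0) (v := 1)
  rw [variance_eq_integral (by fun_prop)] at h
  simp only [id, integral_id_gaussianReal, sub_zero, NNReal.coe_one] at h
  rw [truncatedSecondMoment_eq]
  simp [h]

theorem sq_le_truncatedSecondMoment {a : ℝ} (ha : 0 ≤ a) : a ^ 2 ≤ truncatedSecondMoment a := by
  have hpos := gaussianReal_le_abs_pos ha
  refine le_of_mul_le_mul_right ?_ hpos
  rw [truncatedSecondMoment_mul ha]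
  have h2 : ∫ _ in {z : ℝ | a ≤ |z|}, a ^ 2 ∂(gaussianReal 0 1) =
      a ^ 2 * (gaussianReal 0 1).real {z | a ≤ |z|} := by
    simp [mul_comm]
  rw [← h2]
  refine setIntegral_mono_on (by simp) integrable_sq_gaussianReal.integrableOn
    (measurableSet_le_abs a) fun z hz => ?_
  rw [← sq_abs z]
  exact pow_le_pow_left₀ ha hz 2

/-- Conditionally on `|Z| ≥ a`, the variable `Z²` is of order `a² + 1`: values beyond a multiple of
`(a + 1)²` contribute at most a constant times `exp(-(a + 1)²/2)`, and the tail probability is at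
least a constant times the same quantity. -/
theorem exists_truncatedSecondMoment_le :
    ∃ N : ℝ, 1 ≤ N ∧ ∀ a, 0 ≤ a → truncatedSecondMoment a ≤ N * (a ^ 2 + 1) := by
  set C := ∫ z, 4 * Real.exp (3 / 8 * z ^ 2) * Real.exp (1 / 2) ∂(gaussianReal 0 1) with hC
  have hCint : Integrable (fun z : ℝ => 4 * Real.exp (3 / 8 * z ^ 2) * Real.exp (1 / 2))
      (gaussianReal 0 1) :=
    ((integrable_exp_mul_sq (by norm_num)).const_mul 4).mul_const _
  have hC0 : 0 ≤ C := integral_nonneg fun z => by positivity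
  refine ⟨8 * 4 + C * √(2 * Real.pi), ?_, fun a ha => ?_⟩
  · have : 0 ≤ C * √(2 * Real.pi) := by positivity
    linarith
  have hpos := gaussianReal_le_abs_pos ha
  have hge := gaussianReal_le_abs_ge ha
  refine le_of_mul_le_mul_right ?_ hpos
  rw [truncatedSecondMoment_mul ha]
  set q := (gaussianReal 0 1).real {z | a ≤ |z|} with hq
  set w := a + 1 with hw
  -- For `z² ≥ 16 w²` the product of exponentials is `4 exp(y)` with `y = -w²/2 + 3z²/8 + 1/2`, and
  -- `exp y ≥ 1 + y` suffices. The coefficient `3/8 < 1/2` keeps the bound integrable.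
  have hpt : ∀ z : ℝ, z ^ 2 ≤ 16 * w ^ 2 +
      Real.exp (-w ^ 2 / 2) * (4 * Real.exp (3 / 8 * z ^ 2) * Real.exp (1 / 2)) := by
    intro z
    rcases le_total (z ^ 2) (16 * w ^ 2) with h | h
    · have : 0 ≤ Real.exp (-w ^ 2 / 2) * (4 * Real.exp (3 / 8 * z ^ 2) * Real.exp (1 / 2)) := by
        positivity
      linarith
    · have e1 : Real.exp (-w ^ 2 / 2) * (4 * Real.exp (3 / 8 * z ^ 2) * Real.exp (1 / 2)) =
          4 * Real.exp (-w ^ 2 / 2 + 3 / 8 * z ^ 2 + 1 / 2) := by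
        rw [Real.exp_add, Real.exp_add]; ring
      have e2 := Real.add_one_le_exp (-w ^ 2 / 2 + 3 / 8 * z ^ 2 + 1 / 2)
      rw [e1]
      nlinarith [sq_nonneg w]
  have hint : ∫ z in {z | a ≤ |z|}, z ^ 2 ∂(gaussianReal 0 1) ≤
      16 * w ^ 2 * q + Real.exp (-w ^ 2 / 2) * C := by
    calc _ ≤ ∫ z in {z | a ≤ |z|}, (16 * w ^ 2 + Real.exp (-w ^ 2 / 2) *
          (4 * Real.exp (3 / 8 * z ^ 2) * Real.exp (1 / 2))) ∂(gaussianReal 0 1) := by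
          refine setIntegral_mono integrable_sq_gaussianReal.integrableOn ?_ hpt
          exact ((integrable_const _).add (hCint.const_mul _)).integrableOn
      _ = 16 * w ^ 2 * q + ∫ z in {z | a ≤ |z|}, Real.exp (-w ^ 2 / 2) *
          (4 * Real.exp (3 / 8 * z ^ 2) * Real.exp (1 / 2)) ∂(gaussianReal 0 1) := by
          rw [integral_add (integrable_const _) (hCint.const_mul _).integrableOn]
          simp [mul_comm, hq]
      _ ≤ _ := by
          gcongr
          rw [hC, ← integral_const_mul]
          exact setIntegral_le_integral (hCint.const_mul _) (ae_of_all _ fun z => by positivity)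
  have h3 : Real.exp (-w ^ 2 / 2) ≤ √(2 * Real.pi) * q := by
    have : 0 < √(2 * Real.pi) := by positivity
    calc Real.exp (-w ^ 2 / 2) = √(2 * Real.pi) * ((√(2 * Real.pi))⁻¹ *
          Real.exp (-w ^ 2 / 2)) := by field_simp
      _ ≤ _ := by gcongr
  have h4 : w ^ 2 ≤ 2 * (a ^ 2 + 1) := by nlinarith [sq_nonneg (a - 1)]
  have h5 : Real.exp (-w ^ 2 / 2) * C ≤ √(2 * Real.pi) * q * C * (a ^ 2 + 1) :=
    (mul_le_mul_of_nonneg_right h3 hC0).trans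
      (le_mul_of_one_le_right (by positivity) (by nlinarith))
  have h6 : 16 * w ^ 2 * q ≤ 16 * (2 * (a ^ 2 + 1)) * q := by gcongr
  linarith

open Classical in
/-- The centred truncated square `(z² - ν_a) 1{|z| ≥ a}`. -/
noncomputable def truncatedSquare (a z : ℝ) : ℝ :=
  if a ≤ |z| then z ^ 2 - truncatedSecondMoment a else 0

theorem truncatedSquare_eq_indicator (a : ℝ) : truncatedSquare a =
    Set.indicator {z | a ≤ |z|} (fun z => z ^ 2 - truncatedSecondMoment a) := by
  ext z
  simp [truncatedSquare, Set.indicator]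

theorem measurable_truncatedSquare (a : ℝ) : Measurable (truncatedSquare a) := by
  rw [truncatedSquare_eq_indicator]
  exact Measurable.indicator (by fun_prop) (measurableSet_le_abs a)

theorem integrable_truncatedSquare (a : ℝ) :
    Integrable (truncatedSquare a) (gaussianReal 0 1) := by
  rw [truncatedSquare_eq_indicator]
  exact (integrable_sq_gaussianReal.sub (integrable_const _)).indicator (measurableSet_le_abs a)

theorem integral_truncatedSquare {a : ℝ} (ha : 0 ≤ a) :
    ∫ z, truncatedSquare a z ∂(gaussianReal 0 1) = 0 := by
  rw [truncatedSquare_eq_indicator, integral_indicator (measurableSet_le_abs a), integral_sub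
    integrable_sq_gaussianReal.integrableOn (integrable_const _), ← truncatedSecondMoment_mul ha]
  simp [mul_comm]

theorem sub_le_truncatedSquare {a : ℝ} (ha : 0 ≤ a) (z : ℝ) :
    z ^ 2 - truncatedSecondMoment a ≤ truncatedSquare a z := by
  unfold truncatedSquare
  split_ifs with h
  · rfl
  · have h1 := sq_le_truncatedSecondMoment ha
    have h2 : z ^ 2 ≤ a ^ 2 := by
      rw [← sq_abs z]
      exact pow_le_pow_left₀ (abs_nonneg z) (not_le.mp h).le 2
    linarith

theorem exp_le_one_add_add_sq_mul_exp_abs (x : ℝ) :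
    Real.exp x ≤ 1 + x + x ^ 2 * Real.exp |x| := by
  have h := Complex.norm_exp_sub_sum_le_norm_mul_exp (x : ℂ) 2
  have h2 : Complex.exp (x : ℂ) - ∑ m ∈ Finset.range 2, (x : ℂ) ^ m / (m.factorial : ℂ) =
      ((Real.exp x - (1 + x) : ℝ) : ℂ) := by
    simp [Finset.sum_range_succ]
  rw [h2, Complex.norm_real, Complex.norm_real, Real.norm_eq_abs, Real.norm_eq_abs, sq_abs] at h
  linarith [le_abs_self (Real.exp x - (1 + x))]

/-- The bound `exp x ≤ 1 + x + x² exp |x|` has a linear term that integrates to zero because the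
truncated square is centred. The quadratic term lives on `|z| ≥ a` only, which produces the factor
`exp(-a²/4)`; the constants `κ` and `M` do not depend on `a`. -/
theorem exists_mgf_truncatedSquare_le :
    ∃ κ M : ℝ, 0 < κ ∧ 0 < M ∧ ∀ a l : ℝ, 0 ≤ a → |l| ≤ κ →
      Integrable (fun z => Real.exp (l * truncatedSquare a z)) (gaussianReal 0 1) ∧
      ∫ z, Real.exp (l * truncatedSquare a z) ∂(gaussianReal 0 1) ≤
        Real.exp (M * l ^ 2 * Real.exp (-(a ^ 2 / 4))) := by
  obtain ⟨N, hN1, hN⟩ := exists_truncatedSecondMoment_le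
  set D := 512 * N ^ 2 * Real.exp (1 / 8) with hD
  set E := ∫ z, Real.exp (3 / 8 * z ^ 2) ∂(gaussianReal 0 1) with hE
  have hE1 : 1 ≤ E := one_le_integral_exp_mul_sq (by norm_num) (by norm_num)
  have hint := integrable_exp_mul_sq (c := 3 / 8) (by norm_num)
  have hD0 : 0 < D := by positivity
  -- With this `κ` the exponent `|l Y|` is at most `(z² + 1)/16`. Another such factor pays for `Y²`,
  -- and `z²/4` is spent on the truncation gain; the total coefficient `3/8` of `z²` is below `1/2`.
  refine ⟨1 / (16 * N), D * E, by positivity, by positivity, fun a l ha hl => ?_⟩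
  have hY := integrable_truncatedSquare a
  have hpt : ∀ z, Real.exp (l * truncatedSquare a z) ≤ 1 + l * truncatedSquare a z +
      (l ^ 2 * Real.exp (-(a ^ 2 / 4)) * D) * Real.exp (3 / 8 * z ^ 2) := by
    intro z
    by_cases hz : a ≤ |z|
    · refine (exp_le_one_add_add_sq_mul_exp_abs _).trans ?_
      gcongr 1 + l * truncatedSquare a z + ?_
      have hzs : a ^ 2 ≤ z ^ 2 := by
        rw [← sq_abs z]
        exact pow_le_pow_left₀ ha hz 2
      have hYb : |truncatedSquare a z| ≤ N * (z ^ 2 + 1) := by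
        have h1 := hN a ha
        have h2 := sq_le_truncatedSecondMoment ha
        have h3 : N * (a ^ 2 + 1) ≤ N * (z ^ 2 + 1) := by gcongr
        have h4 : z ^ 2 + 1 ≤ N * (z ^ 2 + 1) := le_mul_of_one_le_left (by positivity) hN1
        rw [truncatedSquare, if_pos hz, abs_le]
        constructor <;> nlinarith [sq_nonneg a, sq_nonneg z]
      have hlY : |l * truncatedSquare a z| ≤ (z ^ 2 + 1) / 16 := by
        rw [abs_mul]
        calc |l| * |truncatedSquare a z| ≤ 1 / (16 * N) * (N * (z ^ 2 + 1)) := by gcongr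
          _ = (z ^ 2 + 1) / 16 := by field_simp
      have hsq : (truncatedSquare a z) ^ 2 ≤ N ^ 2 * (z ^ 2 + 1) ^ 2 := by
        rw [← mul_pow, ← sq_abs]
        exact pow_le_pow_left₀ (abs_nonneg _) hYb 2
      have hexp : (z ^ 2 + 1) ^ 2 ≤ 512 * Real.exp ((z ^ 2 + 1) / 16) := by
        have := Real.quadratic_le_exp_of_nonneg (x := (z ^ 2 + 1) / 16) (by positivity)
        nlinarith [sq_nonneg z]
      -- The source of the factor `exp(-a²/4)`: part of the Gaussian integrability is traded for it
      -- on `|z| ≥ a`.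
      have hone : 1 ≤ Real.exp (z ^ 2 / 4) * Real.exp (-(a ^ 2 / 4)) := by
        rw [← Real.exp_add]
        exact Real.one_le_exp (by linarith)
      calc (l * truncatedSquare a z) ^ 2 * Real.exp |l * truncatedSquare a z|
          = l ^ 2 * (truncatedSquare a z ^ 2 * Real.exp |l * truncatedSquare a z|) := by ring
        _ ≤ l ^ 2 * (N ^ 2 * (512 * Real.exp ((z ^ 2 + 1) / 16)) *
            Real.exp ((z ^ 2 + 1) / 16)) := by
          gcongr
          exact hsq.trans (by gcongr)
        _ ≤ l ^ 2 * (N ^ 2 * (512 * Real.exp ((z ^ 2 + 1) / 16)) *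
            Real.exp ((z ^ 2 + 1) / 16)) *
            (Real.exp (z ^ 2 / 4) * Real.exp (-(a ^ 2 / 4))) :=
          le_mul_of_one_le_right (by positivity) hone
        _ = _ := by
          have : Real.exp (3 / 8 * z ^ 2) * Real.exp (1 / 8) = Real.exp ((z ^ 2 + 1) / 16) *
              Real.exp ((z ^ 2 + 1) / 16) * Real.exp (z ^ 2 / 4) := by
            rw [← Real.exp_add, ← Real.exp_add, ← Real.exp_add]
            ring_nf
          rw [hD]
          linear_combination (-l ^ 2 * N ^ 2 * 512 * Real.exp (-(a ^ 2 / 4))) * this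
    · rw [truncatedSquare, if_neg hz]
      simp only [mul_zero, Real.exp_zero, add_zero]
      have : 0 ≤ l ^ 2 * Real.exp (-(a ^ 2 / 4)) * D * Real.exp (3 / 8 * z ^ 2) := by positivity
      linarith
  have hR : Integrable (fun z => 1 + l * truncatedSquare a z +
      (l ^ 2 * Real.exp (-(a ^ 2 / 4)) * D) * Real.exp (3 / 8 * z ^ 2)) (gaussianReal 0 1) :=
    ((integrable_const _).add (hY.const_mul l)).add (hint.const_mul _)
  have hL : Integrable (fun z => Real.exp (l * truncatedSquare a z)) (gaussianReal 0 1) := by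
    refine hR.mono' ?_ (ae_of_all _ fun z => ?_)
    · have := measurable_truncatedSquare a
      exact (by fun_prop : Measurable fun z => Real.exp (l * truncatedSquare a z)
        ).aestronglyMeasurable
    · rw [Real.norm_of_nonneg (Real.exp_nonneg _)]
      exact hpt z
  refine ⟨hL, ?_⟩
  calc _ ≤ ∫ z, (1 + l * truncatedSquare a z +
      (l ^ 2 * Real.exp (-(a ^ 2 / 4)) * D) * Real.exp (3 / 8 * z ^ 2)) ∂(gaussianReal 0 1) :=
        integral_mono hL hR hpt
    _ = 1 + l ^ 2 * Real.exp (-(a ^ 2 / 4)) * D * E := by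
      have h1 : Integrable (fun z => 1 + l * truncatedSquare a z) (gaussianReal 0 1) :=
        (integrable_const _).add (hY.const_mul l)
      rw [integral_add h1 (hint.const_mul _), integral_add (integrable_const _) (hY.const_mul l),
        integral_const_mul, integral_const_mul, integral_truncatedSquare ha]
      simp [hE]
    _ ≤ Real.exp (l ^ 2 * Real.exp (-(a ^ 2 / 4)) * D * E) := by
      linarith [Real.add_one_le_exp (l ^ 2 * Real.exp (-(a ^ 2 / 4)) * D * E)]
    _ = _ := by ring_nf

/-! ### Chernoff bounds for product measures -/

/-- Markov's inequality for the exponential of the sum, whose integral factorises. The Chernoff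
parameter is absorbed into `f`. -/
theorem pi_real_le_sum_le_exp {ι : Type*} [Fintype ι] {ν : Measure ℝ} [IsProbabilityMeasure ν]
    (f : ι → ℝ → ℝ) (c : ι → ℝ) (hint : ∀ i, Integrable (fun z => Real.exp (f i z)) ν)
    (hf : ∀ i, ∫ z, Real.exp (f i z) ∂ν ≤ Real.exp (c i)) (y : ℝ) :
    (Measure.pi (fun _ : ι => ν)).real {z | y ≤ ∑ i, f i (z i)} ≤ Real.exp (∑ i, c i - y) := by
  have h := mul_meas_ge_le_integral_of_nonneg (μ := Measure.pi (fun _ : ι => ν))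
    (f := fun z => ∏ i, Real.exp (f i (z i))) (ae_of_all _ fun z => by positivity)
    (Integrable.fintype_prod (μ := fun _ => ν) hint) (Real.exp y)
  rw [integral_fintype_prod_eq_prod (μ := fun _ => ν) (fun i z => Real.exp (f i z))] at h
  have h2 : ∏ i, ∫ z, Real.exp (f i z) ∂ν ≤ Real.exp (∑ i, c i) := by
    rw [Real.exp_sum]
    exact Finset.prod_le_prod (fun i _ => integral_nonneg fun z => by positivity) fun i _ => hf i
  have h3 : {z : ι → ℝ | y ≤ ∑ i, f i (z i)} =
      {z | Real.exp y ≤ ∏ i, Real.exp (f i (z i))} := by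
    ext z
    simp [← Real.exp_sum]
  rw [h3, Real.exp_sub, le_div_iff₀ (Real.exp_pos y), mul_comm]
  exact h.trans h2

theorem pi_real_le_sum_finset_le_exp {ι : Type*} [Fintype ι] {ν : Measure ℝ}
    [IsProbabilityMeasure ν] (S : Finset ι) (f : ℝ → ℝ) (c : ℝ)
    (hint : Integrable (fun z => Real.exp (f z)) ν)
    (hf : ∫ z, Real.exp (f z) ∂ν ≤ Real.exp c) (y : ℝ) :
    (Measure.pi (fun _ : ι => ν)).real {z | y ≤ ∑ i ∈ S, f (z i)} ≤
      Real.exp (S.card * c - y) := by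
  classical
  have h := pi_real_le_sum_le_exp (ν := ν) (fun i z => if i ∈ S then f z else 0)
    (fun i => if i ∈ S then c else 0) (fun i => by split_ifs <;> simp [hint])
    (fun i => by split_ifs <;> simp [hf]) y
  simpa [Finset.sum_ite_mem] using h

/-! ### The exponential of a positive integer is not an integer -/

/-- Hermite's argument. For large primes `q` there are `u` prime to `q` and an integer polynomial
`gp` with `u exp(m) - q gp(m)` smaller than `1`. If `exp(m) = N`, this is an integer, hence `0`, so
`q` divides `u N`, which is impossible for `q > N`. -/
theorem exp_natCast_ne_natCast {m : ℕ} (hm : 1 ≤ m) (N : ℕ) : Real.exp m ≠ N := by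
  intro h
  have hN : 0 < N := by
    have : (0 : ℝ) < N := h ▸ Real.exp_pos _
    exact_mod_cast this
  let f : Polynomial ℤ := Polynomial.X - Polynomial.C (m : ℤ)
  have hf : f.eval 0 ≠ 0 := by simp [f]; omega
  obtain ⟨c, hc⟩ := LindemannWeierstrass.exp_polynomial_approx f hf
  have hroot : (m : ℂ) ∈ f.aroots ℂ := by
    rw [Polynomial.mem_aroots]
    exact ⟨Polynomial.X_sub_C_ne_zero _, by simp [f]⟩
  have hlim : Filter.Tendsto (fun k : ℕ => c * (c ^ k / (k.factorial : ℝ))) Filter.atTop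
      (nhds 0) := by
    simpa using (FloorSemiring.tendsto_pow_div_factorial_atTop c).const_mul c
  obtain ⟨k₀, hk₀⟩ := Filter.eventually_atTop.mp (hlim.eventually (gt_mem_nhds one_pos))
  obtain ⟨q, hq, hprime⟩ := Nat.exists_infinite_primes ((f.eval 0).natAbs + N + k₀ + 1)
  obtain ⟨u, hqu, gp, -, hgp⟩ := hc q (by omega) hprime
  have hle := hgp hroot
  have h1 : c ^ q / ((q - 1).factorial : ℝ) < 1 := by
    have := hk₀ (q - 1) (by omega)
    rwa [← mul_div_assoc, ← pow_succ', Nat.sub_add_cancel hprime.one_le] at this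
  have h2 : u • Complex.exp (m : ℂ) - q • (Polynomial.aeval (m : ℂ)) gp =
      ((u * N - q * gp.eval (m : ℤ) : ℤ) : ℂ) := by
    have e1 : Complex.exp (m : ℂ) = (N : ℂ) := by
      have := congrArg Complex.ofReal h
      push_cast at this
      exact this
    have e2 : (Polynomial.aeval (m : ℂ)) gp = ((gp.eval (m : ℤ) : ℤ) : ℂ) := by
      have := Polynomial.aeval_algebraMap_apply ℂ (m : ℤ) gp
      simpa using this
    rw [e1, e2]
    simp
  rw [h2, Complex.norm_intCast] at hle
  have h3 : |u * N - q * gp.eval (m : ℤ)| < 1 := by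
    exact_mod_cast hle.trans_lt h1
  have h4 : u * N = q * gp.eval (m : ℤ) := by
    rw [Int.abs_lt_one_iff] at h3
    linarith
  have h5 : (q : ℤ) ∣ u * N := ⟨_, h4⟩
  rcases (Nat.prime_iff_prime_int.mp hprime).dvd_or_dvd h5 with h6 | h6
  · exact hqu h6
  · have := Nat.le_of_dvd hN (Int.natCast_dvd_natCast.mp h6)
    omega

/-! ### Rates and thresholds -/

section Scores

variable {n p : ℕ}

theorem log_pos_of_two_le (hn : 2 ≤ n) : 0 < Real.log n :=
  Real.log_pos (by exact_mod_cast hn)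

theorem sq_sqrt_mul_log (n p : ℕ) : √(p * Real.log n) ^ 2 = p * Real.log n :=
  Real.sq_sqrt (mul_nonneg (Nat.cast_nonneg _) (Real.log_natCast_nonneg _))

theorem sqrt_mul_log_pos (hn : 2 ≤ n) (hp : 1 ≤ p) : 0 < √(p * Real.log n) := by
  have := log_pos_of_two_le hn
  have : (0 : ℝ) < p := by exact_mod_cast hp
  positivity

/-- Equality would give `exp(t²) = n ^ p`. This excludes the boundary case, where the rate already
takes its dense value while the threshold is still positive. -/
theorem sqrt_mul_log_ne_natCast (hn : 2 ≤ n) {t : ℕ} (ht : 1 ≤ t) : √(p * Real.log n) ≠ t := by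
  intro h
  have h2 := sq_sqrt_mul_log n p
  rw [h] at h2
  refine exp_natCast_ne_natCast (m := t ^ 2) (Nat.one_le_pow _ _ ht) (n ^ p) ?_
  have hn0 : (0 : ℝ) < n := by exact_mod_cast (by omega : 0 < n)
  push_cast
  rw [h2, Real.exp_nat_mul, Real.exp_log hn0]

/-- The logarithmic factor in the definitions of the rate and of the threshold. -/
noncomputable def logFactor (n p t : ℕ) : ℝ :=
  Real.log (Real.exp 1 * p * Real.log n / (t : ℝ) ^ 2)

theorem logFactor_eq (hn : 2 ≤ n) (hp : 1 ≤ p) {t : ℕ} (ht : 1 ≤ t) :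
    logFactor n p t = 1 + 2 * Real.log (√(p * Real.log n) / t) := by
  have hA := sqrt_mul_log_pos hn hp
  have ht' : (0 : ℝ) < t := by exact_mod_cast ht
  have hA2 := sq_sqrt_mul_log n p
  set A := √(p * Real.log n)
  rw [logFactor, mul_assoc, ← hA2, mul_div_assoc, Real.log_mul (by positivity)
    (by positivity), Real.log_exp, ← div_pow, Real.log_pow]
  norm_num

theorem one_le_logFactor (hn : 2 ≤ n) (hp : 1 ≤ p) {t : ℕ} (ht : 1 ≤ t)
    (htA : (t : ℝ) ≤ √(p * Real.log n)) : 1 ≤ logFactor n p t := by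
  have ht' : (0 : ℝ) < t := by exact_mod_cast ht
  rw [logFactor_eq hn hp ht]
  have := Real.log_nonneg ((one_le_div ht').mpr htA)
  linarith

theorem rate_of_lt {t : ℕ} (htA : (t : ℝ) < √(p * Real.log n)) :
    rate n p t = max (t * logFactor n p t) (Real.log n) := by
  rw [rate, if_neg (not_le.mpr htA), logFactor]

theorem rate_of_le {t : ℕ} (htA : √(p * Real.log n) ≤ t) : rate n p t = √(p * Real.log n) := by
  rw [rate, if_pos htA]

theorem threshold_nonneg (n p t : ℕ) : 0 ≤ threshold n p t := by
  rw [threshold]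
  split_ifs <;> positivity

theorem threshold_of_lt {t : ℕ} (htA : √(p * Real.log n) < t) : threshold n p t = 0 := by
  rw [threshold, if_neg (not_le.mpr htA)]

theorem sq_threshold_of_le (hn : 2 ≤ n) (hp : 1 ≤ p) {t : ℕ} (ht : 1 ≤ t)
    (htA : (t : ℝ) ≤ √(p * Real.log n)) : threshold n p t ^ 2 = 4 * logFactor n p t := by
  have := one_le_logFactor hn hp ht htA
  rw [threshold, if_pos htA, ← logFactor, Real.sq_sqrt (by linarith)]

theorem exp_neg_sq_threshold_of_le (hn : 2 ≤ n) (hp : 1 ≤ p) {t : ℕ} (ht : 1 ≤ t)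
    (htA : (t : ℝ) ≤ √(p * Real.log n)) :
    Real.exp (-(threshold n p t ^ 2 / 4)) = (t : ℝ) ^ 2 / (Real.exp 1 * p * Real.log n) := by
  have ht' : (0 : ℝ) < t := by exact_mod_cast ht
  have hp' : (0 : ℝ) < p := by exact_mod_cast hp
  have := log_pos_of_two_le hn
  rw [sq_threshold_of_le hn hp ht htA, mul_div_cancel_left₀ _ (by norm_num), logFactor,
    ← Real.log_inv, Real.exp_log (by positivity), inv_div]

theorem log_le_sqrt_mul_log (h : Real.log n ≤ p) : Real.log n ≤ √(p * Real.log n) := by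
  refine Real.le_sqrt_of_sq_le ?_
  have := Real.log_natCast_nonneg n
  nlinarith

theorem log_le_of_sqrt_mul_log_le (hn : 2 ≤ n) (hp : 1 ≤ p) (h : √(p * Real.log n) ≤ p) :
    Real.log n ≤ p := by
  have hp' : (0 : ℝ) < p := by exact_mod_cast hp
  have h1 := sq_sqrt_mul_log n p
  have h2 := (sqrt_mul_log_pos hn hp).le
  nlinarith

/-- A sparsity is regular if its rate is at least `log n`. -/
theorem log_le_rate {t : ℕ} (h : (t : ℝ) < √(p * Real.log n) ∨ Real.log n ≤ p) :
    Real.log n ≤ rate n p t := by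
  rcases lt_or_ge (t : ℝ) √(p * Real.log n) with h1 | h1
  · rw [rate_of_lt h1]
    exact le_max_right _ _
  · rw [rate_of_le h1]
    exact log_le_sqrt_mul_log (h.resolve_left (not_lt.mpr h1))

theorem log_le_rate_of_le (hn : 2 ≤ n) (hp : 1 ≤ p) {k : ℕ} (hk : k ≤ p) :
    Real.log n ≤ rate n p k := by
  refine log_le_rate ?_
  rcases lt_or_ge (k : ℝ) √(p * Real.log n) with h1 | h1
  · exact Or.inl h1
  · exact Or.inr (log_le_of_sqrt_mul_log_le hn hp (h1.trans (by exact_mod_cast hk)))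

open Classical in
/-- The exponent in the tail bounds for the penalised scores. -/
noncomputable def tailExponent (n p t : ℕ) : ℝ :=
  if (t : ℝ) < √(p * Real.log n) then min (rate n p t) (Real.log n * logFactor n p t ^ 2)
  else Real.log n

theorem log_le_tailExponent (hn : 2 ≤ n) (hp : 1 ≤ p) {t : ℕ} (ht : 1 ≤ t) :
    Real.log n ≤ tailExponent n p t := by
  rw [tailExponent]
  split_ifs with h
  · refine le_min (log_le_rate (Or.inl h)) ?_
    have h1 := one_le_logFactor hn hp ht h.le
    have h2 := (log_pos_of_two_le hn).le
    exact le_mul_of_one_le_right h2 (by nlinarith)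
  · rfl

/-- Write `L` for the logarithmic factor and `A = √(p log n)`. For `t < A` the variance term is at
most `M l² t² / log n`. If `t ≤ L log n`, take `l = κ`, the largest value allowed, and the variance
term is of order `r(t)`. Otherwise `l = κ L log n / t` balances the terms at `L² log n`. For `t > A`
there is no truncation, and `l = κ log n / A` balances them at `log n`. These are the values in
`tailExponent`. -/
theorem exists_chernoff_parameter (hn : 2 ≤ n) (hp : 1 ≤ p) {t : ℕ} (ht : 1 ≤ t)
    (h : (t : ℝ) < √(p * Real.log n) ∨ Real.log n ≤ p) {κ M g : ℝ} (hκ : 0 < κ) (hM : 0 < M)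
    (hg : M * κ ≤ g) :
    ∃ l, 0 < l ∧ l ≤ κ ∧
      p * (M * l ^ 2 * Real.exp (-(threshold n p t ^ 2 / 4))) - l * (g * rate n p t) ≤
        -((κ * g - M * κ ^ 2) * tailExponent n p t) := by
  have hlg := log_pos_of_two_le hn
  have hA := sqrt_mul_log_pos hn hp
  have hA2 := sq_sqrt_mul_log n p
  have hp' : (0 : ℝ) < p := by exact_mod_cast hp
  have ht' : (0 : ℝ) < t := by exact_mod_cast ht
  have hG : 0 ≤ κ * g - M * κ ^ 2 := by nlinarith
  have hg0 : 0 < g := lt_of_lt_of_le (by positivity) hg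
  rcases lt_or_ge (t : ℝ) √(p * Real.log n) with h1 | h1
  · have hL := one_le_logFactor hn hp ht h1.le
    have hr := rate_of_lt h1
    have hr1 : t * logFactor n p t ≤ rate n p t := hr ▸ le_max_left _ _
    rw [exp_neg_sq_threshold_of_le hn hp ht h1.le, tailExponent, if_pos h1]
    set L := logFactor n p t
    set r := rate n p t
    have he : 1 ≤ Real.exp 1 := Real.one_le_exp zero_le_one
    have key : ∀ l : ℝ, p * (M * l ^ 2 * ((t : ℝ) ^ 2 / (Real.exp 1 * p * Real.log n))) ≤
        M * l ^ 2 * ((t : ℝ) ^ 2 / Real.log n) := by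
      intro l
      have : p * (M * l ^ 2 * ((t : ℝ) ^ 2 / (Real.exp 1 * p * Real.log n))) =
          M * l ^ 2 * ((t : ℝ) ^ 2 / Real.log n) / Real.exp 1 := by
        field_simp
      rw [this]
      exact div_le_self (by positivity) he
    rcases le_total (t : ℝ) (Real.log n * L) with h2 | h2
    · refine ⟨κ, hκ, le_rfl, ?_⟩
      have h3 : (t : ℝ) ^ 2 / Real.log n ≤ r := by
        rw [div_le_iff₀ hlg]
        calc (t : ℝ) ^ 2 ≤ t * (Real.log n * L) := by rw [sq]; gcongr
          _ = t * L * Real.log n := by ring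
          _ ≤ _ := by gcongr
      have h4 : M * κ ^ 2 * ((t : ℝ) ^ 2 / Real.log n) ≤ M * κ ^ 2 * r := by gcongr
      have h5 : (κ * g - M * κ ^ 2) * min r (Real.log n * L ^ 2) ≤ (κ * g - M * κ ^ 2) * r := by
        gcongr
        exact min_le_left _ _
      have := key κ
      linarith
    · refine ⟨κ * (Real.log n * L / t), by positivity, ?_, ?_⟩
      · exact mul_le_of_le_one_right hκ.le ((div_le_one ht').mpr h2)
      · have h3 := key (κ * (Real.log n * L / t))
        have h4 : M * (κ * (Real.log n * L / t)) ^ 2 * ((t : ℝ) ^ 2 / Real.log n) =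
            M * κ ^ 2 * (Real.log n * L ^ 2) := by
          field_simp
        have h5 : κ * g * (Real.log n * L ^ 2) ≤ κ * (Real.log n * L / t) * (g * r) := by
          calc κ * g * (Real.log n * L ^ 2) = κ * (Real.log n * L / t) * (g * (t * L)) := by
                field_simp
            _ ≤ _ := by gcongr
        have h6 : (κ * g - M * κ ^ 2) * min r (Real.log n * L ^ 2) ≤
            (κ * g - M * κ ^ 2) * (Real.log n * L ^ 2) := by
          gcongr
          exact min_le_right _ _
        linarith
  · have h2 : √(p * Real.log n) < t := lt_of_le_of_ne h1 (sqrt_mul_log_ne_natCast hn ht)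
    have h3 := log_le_sqrt_mul_log (h.resolve_left (not_lt.mpr h1))
    rw [threshold_of_lt h2, rate_of_le h1, tailExponent, if_neg (not_lt.mpr h1)]
    set A := √(p * Real.log n)
    refine ⟨κ * (Real.log n / A), by positivity,
      mul_le_of_le_one_right hκ.le ((div_le_one hA).mpr h3), le_of_eq ?_⟩
    simp only [ne_eq, OfNat.ofNat_ne_zero, not_false_eq_true, zero_pow, zero_div, neg_zero,
      Real.exp_zero, mul_one]
    have h4 : p * (M * (κ * (Real.log n / A)) ^ 2) = M * κ ^ 2 * Real.log n := by
      rw [mul_pow, div_pow, hA2]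
      field_simp
    rw [h4]
    field_simp
    ring

/-- The sign `ε` covers both tails. Subsets `S` are needed to treat separately the coordinates
without signal. -/
theorem exists_tail_bound :
    ∃ κ M : ℝ, 0 < κ ∧ 0 < M ∧ ∀ {n p : ℕ}, 2 ≤ n → 1 ≤ p → ∀ {t : ℕ}, 1 ≤ t →
      ((t : ℝ) < √(p * Real.log n) ∨ Real.log n ≤ p) → ∀ (S : Finset (Fin p)) (ε : ℝ), |ε| = 1 →
      ∀ g, M * κ ≤ g → (Measure.pi (fun _ : Fin p => gaussianReal 0 1)).real
        {z | g * rate n p t ≤ ∑ i ∈ S, ε * truncatedSquare (threshold n p t) (z i)} ≤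
        Real.exp (-((κ * g - M * κ ^ 2) * tailExponent n p t)) := by
  obtain ⟨κ, M, hκ, hM, h⟩ := exists_mgf_truncatedSquare_le
  refine ⟨κ, M, hκ, hM, fun {n p} hn hp {t} ht hreg S ε hε g hg => ?_⟩
  obtain ⟨l, hl0, hlκ, hl⟩ := exists_chernoff_parameter hn hp ht hreg hκ hM hg
  have habs : |l * ε| ≤ κ := by rw [abs_mul, hε, mul_one, abs_of_pos hl0]; exact hlκ
  obtain ⟨hint, hmgf⟩ := h (threshold n p t) (l * ε) (threshold_nonneg n p t) habs
  have hε2 : ε ^ 2 = 1 := by rw [← sq_abs, hε, one_pow]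
  have hset : {z : Fin p → ℝ | g * rate n p t ≤
      ∑ i ∈ S, ε * truncatedSquare (threshold n p t) (z i)} = {z | l * (g * rate n p t) ≤
      ∑ i ∈ S, l * ε * truncatedSquare (threshold n p t) (z i)} := by
    ext z
    simp only [Set.mem_ofPred_eq, mul_assoc l ε, ← Finset.mul_sum]
    rw [mul_le_mul_iff_right₀ hl0]
  rw [hset]
  refine (pi_real_le_sum_finset_le_exp S _ _ hint hmgf _).trans (Real.exp_le_exp.mpr ?_)
  refine le_trans ?_ hl
  rw [mul_pow, hε2, mul_one]
  have : (S.card : ℝ) ≤ p := by exact_mod_cast (Finset.card_le_univ S).trans_eq (by simp)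
  gcongr

/-! ### Scores as functions of the transformed data -/

/-- The penalised score as a function of the vector of CUSUM statistics. -/
noncomputable def vectorScore (n : ℕ) {p : ℕ} (γ : ℕ → ℝ) (c : Fin p → ℝ) : ℝ :=
  (sparsityGrid n p).sup' (Finset.insert_nonempty _ _)
    fun t => ∑ i, truncatedSquare (threshold n p t) (c i) - γ t

theorem score_eq_vectorScore (x : ℕ → EuclideanSpace ℝ (Fin p)) (γ : ℕ → ℝ) (s e v : ℕ) :
    score n x γ s e v = vectorScore n γ fun i => cusum s e v fun u => x u i := rfl

theorem one_le_of_mem_sparsityGrid (hp : 1 ≤ p) {t : ℕ} (ht : t ∈ sparsityGrid n p) : 1 ≤ t := by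
  simp only [sparsityGrid, Finset.mem_insert, Finset.mem_image, Finset.mem_range] at ht
  rcases ht with rfl | ⟨i, -, rfl⟩
  · exact hp
  · exact Nat.one_le_two_pow

theorem two_pow_le_sqrt {i : ℕ} (h : 1 ≤ √(p * Real.log n))
    (hi : i ≤ Nat.log 2 ⌊√(p * Real.log n)⌋₊) : (2 : ℝ) ^ i ≤ √(p * Real.log n) := by
  have h1 : ⌊√(p * Real.log n)⌋₊ ≠ 0 := (Nat.floor_pos.mpr h).ne'
  have h2 : 2 ^ i ≤ ⌊√(p * Real.log n)⌋₊ :=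
    (Nat.pow_le_pow_right two_pos hi).trans (Nat.pow_log_le_self 2 h1)
  have h3 := (Nat.le_floor_iff (Real.sqrt_nonneg _)).mp h2
  exact_mod_cast h3

theorem log_le_of_sqrt_lt_one (hp : 1 ≤ p) (h : √(p * Real.log n) < 1) : Real.log n ≤ p := by
  have h1 := sq_sqrt_mul_log n p
  have h2 := Real.sqrt_nonneg (p * Real.log n)
  have h3 := Real.log_natCast_nonneg n
  have hp' : (1 : ℝ) ≤ p := by exact_mod_cast hp
  nlinarith

theorem lt_or_log_le_of_mem_sparsityGrid (hn : 2 ≤ n) (hp : 1 ≤ p) {t : ℕ}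
    (ht : t ∈ sparsityGrid n p) : (t : ℝ) < √(p * Real.log n) ∨ Real.log n ≤ p := by
  have ht1 := one_le_of_mem_sparsityGrid hp ht
  simp only [sparsityGrid, Finset.mem_insert, Finset.mem_image, Finset.mem_range] at ht
  rcases ht with rfl | ⟨i, hi, rfl⟩
  · rcases lt_or_ge (t : ℝ) √(t * Real.log n) with h | h
    · exact Or.inl h
    · exact Or.inr (log_le_of_sqrt_mul_log_le hn hp h)
  · rcases lt_or_ge √(p * Real.log n) 1 with h | h
    · exact Or.inr (log_le_of_sqrt_lt_one hp h)
    · left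
      have h1 := two_pow_le_sqrt h (Nat.lt_succ_iff.mp hi)
      exact lt_of_le_of_ne (by exact_mod_cast h1)
        (fun h2 => sqrt_mul_log_ne_natCast hn ht1 h2.symm)

/-- The exponent grows away from each end of the grid: `r(2 ^ i) ≥ 2 ^ i ≥ i` counts from the
bottom, and `L ≥ 1 + (I - i)`, with `I` the top index, counts from the top. Whichever term attains
the minimum, one of two geometric series dominates, so the union over sparsities costs only a
constant factor. -/
theorem exp_neg_tailExponent_two_pow_le (hn : 2 ≤ n) (hp : 1 ≤ p) {i : ℕ}
    (hi : i ≤ Nat.log 2 ⌊√(p * Real.log n)⌋₊) :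
    Real.exp (-(20 * tailExponent n p (2 ^ i))) ≤ Real.exp (-(10 * Real.log n)) * (1 / 2) ^ i +
      Real.exp (-(10 * Real.log n)) * (1 / 2) ^ (Nat.log 2 ⌊√(p * Real.log n)⌋₊ - i) := by
  set I := Nat.log 2 ⌊√(p * Real.log n)⌋₊ with hI
  have hlog2 : (1 / 2 : ℝ) < Real.log 2 := by linarith [Real.log_two_gt_d9]
  have hlogn : Real.log 2 ≤ Real.log n := Real.log_le_log two_pos (by exact_mod_cast hn)
  have hhalf : ∀ j : ℕ, ((1 : ℝ) / 2) ^ j = Real.exp (-(Real.log 2 * j)) := by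
    intro j
    rw [one_div, inv_pow, mul_comm, Real.exp_neg, Real.exp_nat_mul, Real.exp_log two_pos]
  have hlog21 : Real.log 2 < 1 := by linarith [Real.log_two_lt_d9]
  rw [hhalf, hhalf, ← Real.exp_add, ← Real.exp_add]
  by_cases hA : (2 : ℝ) ^ i < √(p * Real.log n)
  · have hcast : ((2 ^ i : ℕ) : ℝ) < √(p * Real.log n) := by exact_mod_cast hA
    have h1A : 1 ≤ √(p * Real.log n) := (one_le_pow₀ (by norm_num)).trans hA.le
    have hIA := two_pow_le_sqrt h1A hI.le
    have hL1 := one_le_logFactor hn hp Nat.one_le_two_pow hcast.le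
    have hL : 1 + ((I - i : ℕ) : ℝ) ≤ logFactor n p (2 ^ i) := by
      rw [logFactor_eq hn hp Nat.one_le_two_pow]
      have h1 : (2 : ℝ) ^ (I - i) ≤ √(p * Real.log n) / ((2 ^ i : ℕ) : ℝ) := by
        push_cast
        rw [le_div_iff₀ (by positivity), ← pow_add, Nat.sub_add_cancel hi]
        exact hIA
      have h2 := Real.log_le_log (by positivity) h1
      rw [Real.log_pow] at h2
      have h3 : (0 : ℝ) ≤ ((I - i : ℕ) : ℝ) := Nat.cast_nonneg _
      nlinarith
    have hr1 : ((2 ^ i : ℕ) : ℝ) * logFactor n p (2 ^ i) ≤ rate n p (2 ^ i) :=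
      rate_of_lt hcast ▸ le_max_left _ _
    have hr2 : Real.log n ≤ rate n p (2 ^ i) := log_le_rate (Or.inl hcast)
    have hi2 : (i : ℝ) ≤ ((2 ^ i : ℕ) : ℝ) := by exact_mod_cast (Nat.lt_two_pow_self).le
    rw [tailExponent, if_pos hcast]
    rcases le_total (rate n p (2 ^ i)) (Real.log n * logFactor n p (2 ^ i) ^ 2) with h | h
    · rw [min_eq_left h]
      refine le_add_of_le_of_nonneg (Real.exp_le_exp.mpr ?_) (Real.exp_nonneg _)
      have h4 : (i : ℝ) ≤ rate n p (2 ^ i) := by nlinarith [Nat.cast_nonneg (α := ℝ) i]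
      have h5 : (0 : ℝ) ≤ i := Nat.cast_nonneg _
      nlinarith
    · rw [min_eq_right h]
      refine le_add_of_nonneg_of_le (Real.exp_nonneg _) (Real.exp_le_exp.mpr ?_)
      have h3 : (0 : ℝ) ≤ ((I - i : ℕ) : ℝ) := Nat.cast_nonneg _
      have h4 : 1 + ((I - i : ℕ) : ℝ) ≤ logFactor n p (2 ^ i) ^ 2 := by nlinarith
      have h5 : Real.log n * (1 + ((I - i : ℕ) : ℝ)) ≤ Real.log n * logFactor n p (2 ^ i) ^ 2 := by
        have := (log_pos_of_two_le hn).le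
        gcongr
      nlinarith
  -- A grid point not below `√(p log n)` occurs only when the dyadic grid is `{1}`; equality with
  -- the square root is impossible.
  · have h0 : I = 0 := by
      rcases lt_or_ge √(p * Real.log n) 1 with h | h
      · rw [hI, Nat.floor_eq_zero.mpr h, Nat.log_zero_right]
      · have h1 := two_pow_le_sqrt h hi
        have h2 : (2 : ℝ) ^ i = √(p * Real.log n) := le_antisymm h1 (not_lt.mp hA)
        exact absurd (by exact_mod_cast h2.symm)
          (sqrt_mul_log_ne_natCast (p := p) (t := 2 ^ i) hn Nat.one_le_two_pow)
    have hi0 : i = 0 := by omega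
    refine le_add_of_le_of_nonneg (Real.exp_le_exp.mpr ?_) (Real.exp_nonneg _)
    have := log_le_tailExponent hn hp (t := 2 ^ i) Nat.one_le_two_pow
    have h5 := log_pos_of_two_le hn
    rw [hi0] at this ⊢
    rw [Nat.cast_zero]
    linarith

theorem sum_sparsityGrid_exp_neg_tailExponent_le (hn : 2 ≤ n) (hp : 1 ≤ p) :
    ∑ t ∈ sparsityGrid n p, Real.exp (-(20 * tailExponent n p t)) ≤ ((n : ℝ) ^ 6)⁻¹ := by
  classical
  set I := Nat.log 2 ⌊√(p * Real.log n)⌋₊ with hI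
  set E := Real.exp (-(10 * Real.log n)) with hE
  have hn0 : (0 : ℝ) < n := by exact_mod_cast (by omega : 0 < n)
  have hE' : E = ((n : ℝ) ^ 10)⁻¹ := by
    rw [hE, Real.exp_neg]
    congr 1
    rw [show (10 : ℝ) = ((10 : ℕ) : ℝ) by norm_num, Real.exp_nat_mul, Real.exp_log hn0]
  have hlg := log_pos_of_two_le hn
  have hpterm : Real.exp (-(20 * tailExponent n p p)) ≤ E := by
    refine Real.exp_le_exp.mpr ?_
    have := log_le_tailExponent hn hp hp
    linarith
  have hgeom : ∀ m : ℕ, ∑ i ∈ Finset.range m, ((1 : ℝ) / 2) ^ i ≤ 2 := fun m => by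
    have := Summable.sum_le_tsum (Finset.range m) (fun i _ => by positivity)
      summable_geometric_two
    rwa [tsum_geometric_two] at this
  have h1 : ∑ t ∈ (Finset.range (I + 1)).image (fun i => 2 ^ i),
      Real.exp (-(20 * tailExponent n p t)) ≤ E * 2 + E * 2 := by
    rw [Finset.sum_image fun i _ j _ h => Nat.pow_right_injective le_rfl h]
    calc _ ≤ ∑ i ∈ Finset.range (I + 1), (E * (1 / 2) ^ i + E * (1 / 2) ^ (I - i)) :=
          Finset.sum_le_sum fun i hi => exp_neg_tailExponent_two_pow_le hn hp
            (Nat.lt_succ_iff.mp (Finset.mem_range.mp hi))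
      _ = E * ∑ i ∈ Finset.range (I + 1), (1 / 2) ^ i +
          E * ∑ i ∈ Finset.range (I + 1), (1 / 2) ^ i := by
          rw [Finset.sum_add_distrib, ← Finset.mul_sum, ← Finset.mul_sum,
            ← Finset.sum_range_reflect (fun i => ((1 : ℝ) / 2) ^ i) (I + 1)]
          simp only [Nat.add_sub_cancel]
      _ ≤ _ := by
          have := hgeom (I + 1)
          have hE0 : 0 ≤ E := Real.exp_nonneg _
          gcongr
  have h2 : ∑ t ∈ sparsityGrid n p, Real.exp (-(20 * tailExponent n p t)) ≤ E * 5 := by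
    rw [sparsityGrid]
    by_cases hmem : p ∈ (Finset.range (I + 1)).image (fun i => 2 ^ i)
    · rw [Finset.insert_eq_of_mem hmem]
      have hE0 : 0 ≤ E := Real.exp_nonneg _
      linarith
    · rw [Finset.sum_insert hmem]
      linarith
  refine h2.trans ?_
  rw [hE']
  have hn2 : (2 : ℝ) ≤ n := by exact_mod_cast hn
  have h16 : (16 : ℝ) ≤ n ^ 4 := by
    calc (16 : ℝ) = 2 ^ 4 := by norm_num
      _ ≤ _ := by gcongr
  rw [inv_mul_le_iff₀ (by positivity), show (n : ℝ) ^ 10 = n ^ 4 * n ^ 6 by ring,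
    mul_inv_cancel_right₀ (by positivity)]
  linarith

/-! ### Size and power of the penalised scores -/

theorem exp_neg_mul_log (hn : 2 ≤ n) (m : ℕ) :
    Real.exp (-(m * Real.log n)) = ((n : ℝ) ^ m)⁻¹ := by
  have hn0 : (0 : ℝ) < n := by exact_mod_cast (by omega : 0 < n)
  rw [Real.exp_neg, Real.exp_nat_mul, Real.exp_log hn0]

theorem exp_add_exp_le_inv_pow (hn : 2 ≤ n) {x y : ℝ} (hx : 10 * Real.log n ≤ x)
    (hy : 10 * Real.log n ≤ y) : Real.exp (-x) + Real.exp (-y) ≤ ((n : ℝ) ^ 6)⁻¹ := by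
  have hn2 : (2 : ℝ) ≤ n := by exact_mod_cast hn
  have hn0 : (0 : ℝ) < n := by linarith
  have h := exp_neg_mul_log hn 10
  push_cast at h
  have h1 : Real.exp (-x) ≤ ((n : ℝ) ^ 10)⁻¹ := h ▸ Real.exp_le_exp.mpr (by linarith)
  have h2 : Real.exp (-y) ≤ ((n : ℝ) ^ 10)⁻¹ := h ▸ Real.exp_le_exp.mpr (by linarith)
  have h16 : (16 : ℝ) ≤ n ^ 4 := by
    calc (16 : ℝ) = 2 ^ 4 := by norm_num
      _ ≤ _ := by gcongr
  have h3 : 2 * ((n : ℝ) ^ 10)⁻¹ ≤ ((n : ℝ) ^ 6)⁻¹ := by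
    rw [show (n : ℝ) ^ 10 = n ^ 4 * n ^ 6 by ring, mul_inv, ← mul_assoc]
    refine mul_le_of_le_one_left (by positivity) ?_
    rw [← div_eq_mul_inv, div_le_one (by positivity)]
    linarith
  linarith

/-- Passing from `k` down to `t ≥ k/2` adds at most `2 log 2 < 2` to the logarithmic factor, which
is at least `1` at `k`. -/
theorem rate_le_three_mul_rate (hn : 2 ≤ n) (hp : 1 ≤ p) {t k : ℕ} (ht : 1 ≤ t) (htk : t ≤ k)
    (hk2 : k ≤ 2 * t) (hkA : (k : ℝ) < √(p * Real.log n)) : rate n p t ≤ 3 * rate n p k := by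
  have htk' : (t : ℝ) ≤ k := by exact_mod_cast htk
  have hk2' : (k : ℝ) ≤ 2 * t := by exact_mod_cast hk2
  have ht0 : (0 : ℝ) < t := by exact_mod_cast ht
  have hk1 : 1 ≤ k := ht.trans htk
  have hk0 : (0 : ℝ) < k := ht0.trans_le htk'
  have hA := sqrt_mul_log_pos hn hp
  have hL := one_le_logFactor hn hp hk1 hkA.le
  have hlg := log_pos_of_two_le hn
  rw [rate_of_lt hkA, rate_of_lt (htk'.trans_lt hkA)]
  have hlog : logFactor n p t ≤ 3 * logFactor n p k := by
    have h1 : Real.log (√(p * Real.log n) / t) ≤ Real.log 2 + Real.log (√(p * Real.log n) / k) := by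
      rw [← Real.log_mul (by norm_num) (by positivity)]
      refine Real.log_le_log (by positivity) ?_
      rw [← mul_div_assoc, div_le_div_iff₀ ht0 hk0]
      nlinarith
    have h2 := Real.log_two_lt_d9
    rw [logFactor_eq hn hp hk1] at hL ⊢
    rw [logFactor_eq hn hp ht]
    linarith
  refine max_le ?_ ?_
  · have hLt : 0 ≤ logFactor n p t :=
      zero_le_one.trans (one_le_logFactor hn hp ht (htk'.trans hkA.le))
    calc t * logFactor n p t ≤ k * (3 * logFactor n p k) := by gcongr
      _ = 3 * (k * logFactor n p k) := by ring
      _ ≤ _ := by gcongr; exact le_max_left _ _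
  · have := le_max_right (k * logFactor n p k) (Real.log n)
    linarith

theorem le_vectorScore {γ : ℕ → ℝ} {c : Fin p → ℝ} {t : ℕ} (ht : t ∈ sparsityGrid n p) :
    ∑ i, truncatedSquare (threshold n p t) (c i) - γ t ≤ vectorScore n γ c :=
  Finset.le_sup' (fun t => ∑ i, truncatedSquare (threshold n p t) (c i) - γ t) ht

theorem pi_vectorScore_pos_le {γ₀ : ℝ}
    (h : ∀ t ∈ sparsityGrid n p, (Measure.pi (fun _ : Fin p => gaussianReal 0 1)).real
        {z | γ₀ * rate n p t ≤ ∑ i, truncatedSquare (threshold n p t) (z i)} ≤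
        Real.exp (-(20 * tailExponent n p t))) (hn : 2 ≤ n) (hp : 1 ≤ p) :
    (Measure.pi (fun _ : Fin p => gaussianReal 0 1)).real
      {z | 0 < vectorScore n (fun t => γ₀ * rate n p t) z} ≤ ((n : ℝ) ^ 6)⁻¹ := by
  refine le_trans ?_ (sum_sparsityGrid_exp_neg_tailExponent_le hn hp)
  refine le_trans ?_ (Finset.sum_le_sum h)
  refine le_trans (measureReal_mono ?_ (measure_ne_top _ _)) (measureReal_biUnion_finset_le _ _)
  intro z hz
  obtain ⟨t, ht, h0⟩ := (Finset.lt_sup'_iff _).mp (show 0 < vectorScore n _ z from hz)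
  simp only [Set.mem_iUnion]
  exact ⟨t, ht, (sub_pos.mp h0).le⟩

/-- Controls the cross term `2 ∑ b z` from below by `-(∑ b²)/2`. The factor `1/4` is the Chernoff
parameter, optimal for this level. -/
theorem pi_sum_mul_le_neg_le {ι : Type*} [Fintype ι] (b : ι → ℝ) :
    (Measure.pi (fun _ : ι => gaussianReal 0 1)).real
      {z | (∑ i, b i ^ 2) / 16 ≤ ∑ i, (-(b i / 4)) * z i} ≤
      Real.exp (-((∑ i, b i ^ 2) / 32)) := by
  have hmgf : ∀ l : ℝ, ∫ z, Real.exp (l * z) ∂(gaussianReal 0 1) = Real.exp (l ^ 2 / 2) := by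
    intro l
    have := mgf_gaussianReal (p := gaussianReal 0 1) (X := id) (μ := 0) (v := 1) (by simp) l
    simpa [mgf] using this
  refine (pi_real_le_sum_le_exp (ν := gaussianReal 0 1) (fun i z => (-(b i / 4)) * z)
    (fun i => b i ^ 2 / 32) (fun i => integrable_exp_mul_gaussianReal _) (fun i => ?_) _).trans
    (le_of_eq ?_)
  · rw [hmgf]
    refine le_of_eq ?_
    congr 1
    ring
  · rw [← Finset.sum_div]
    ring_nf

theorem exists_pi_sum_sq_ge_le :
    ∃ K : ℝ, 0 ≤ K ∧ ∀ {ι : Type} [Fintype ι] (S : Finset ι) (y : ℝ),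
      (Measure.pi (fun _ : ι => gaussianReal 0 1)).real {z | y ≤ ∑ i ∈ S, z i ^ 2} ≤
        Real.exp (S.card * K - y / 4) := by
  have h1 := one_le_integral_exp_mul_sq (c := 1 / 4) (by norm_num) (by norm_num)
  refine ⟨Real.log (∫ z, Real.exp (1 / 4 * z ^ 2) ∂(gaussianReal 0 1)), Real.log_nonneg h1,
    fun {ι} _ S y => ?_⟩
  refine le_trans (le_of_eq ?_) (pi_real_le_sum_finset_le_exp S (fun z => 1 / 4 * z ^ 2) _
    (integrable_exp_mul_sq (by norm_num)) (Real.exp_log (by linarith)).ge (y / 4))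
  congr 1
  ext z
  simp only [Set.mem_ofPred_eq, ← Finset.mul_sum]
  constructor <;> intro h <;> linarith

theorem truncatedSquare_zero (z : ℝ) : truncatedSquare 0 z = z ^ 2 - 1 := by
  rw [truncatedSquare, if_pos (abs_nonneg z), truncatedSecondMoment_zero]

/-- At the grid point `p` nothing is truncated, so the square expands exactly. The cross term costs
at most half of `∑ b²`; the remaining `2 g √(p log n)` pays for the centred noise and for the
penalty. -/
theorem vectorScore_pos_of_dense (hpA : √(p * Real.log n) < p) {g : ℝ}
    {b z : Fin p → ℝ} (hb : 4 * g * √(p * Real.log n) ≤ ∑ i, b i ^ 2)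
    (h1 : ∑ i, (-1) * truncatedSquare (threshold n p p) (z i) < g * rate n p p)
    (h2 : ∑ i, (-(b i / 4)) * z i < (∑ i, b i ^ 2) / 16) :
    0 < vectorScore n (fun t => g * rate n p t) (fun i => b i + z i) := by
  refine lt_of_lt_of_le ?_ (le_vectorScore (Finset.mem_insert_self _ _))
  rw [threshold_of_lt hpA, rate_of_le hpA.le] at *
  simp only [truncatedSquare_zero] at *
  have e : ∑ i, ((b i + z i) ^ 2 - 1) = ∑ i, b i ^ 2 - 8 * ∑ i, (-(b i / 4)) * z i -
      ∑ i, (-1) * (z i ^ 2 - 1) := by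
    rw [Finset.mul_sum, ← Finset.sum_sub_distrib, ← Finset.sum_sub_distrib]
    exact Finset.sum_congr rfl fun i _ => by ring
  rw [e]
  linarith

/-- On the support the truncated square is at least `(b + z)² - ν ≥ b²/2 - z² - ν`, even below the
threshold, since `ν_a ≥ a²`. Half of `∑ b²` pays for `D` (noise on the support), `B` (centring), and
twice `g` (noise off the support and the penalty). -/
theorem vectorScore_pos_of_sparse {t : ℕ} (ht : t ∈ sparsityGrid n p) {g D B : ℝ}
    {b z : Fin p → ℝ} {S : Finset (Fin p)} (hS : ∀ i ∉ S, b i = 0)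
    (hν : S.card * truncatedSecondMoment (threshold n p t) ≤ B * rate n p t)
    (hb : 2 * (2 * g + D + B) * rate n p t ≤ ∑ i, b i ^ 2)
    (h1 : ∑ i ∈ Sᶜ, (-1) * truncatedSquare (threshold n p t) (z i) < g * rate n p t)
    (h2 : ∑ i ∈ S, z i ^ 2 < D * rate n p t) :
    0 < vectorScore n (fun t => g * rate n p t) (fun i => b i + z i) := by
  refine lt_of_lt_of_le ?_ (le_vectorScore ht)
  have hbS : ∑ i, b i ^ 2 = ∑ i ∈ S, b i ^ 2 :=
    (Finset.sum_subset (Finset.subset_univ S) fun i _ hi => by rw [hS i hi]; ring).symm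
  have h3 : ∑ i ∈ Sᶜ, truncatedSquare (threshold n p t) (b i + z i) =
      ∑ i ∈ Sᶜ, truncatedSquare (threshold n p t) (z i) :=
    Finset.sum_congr rfl fun i hi => by rw [hS i (Finset.mem_compl.mp hi), zero_add]
  have h4 : ∑ i ∈ S, b i ^ 2 / 2 - ∑ i ∈ S, z i ^ 2 -
      S.card * truncatedSecondMoment (threshold n p t) ≤
      ∑ i ∈ S, truncatedSquare (threshold n p t) (b i + z i) := by
    rw [← nsmul_eq_mul, ← Finset.sum_const, ← Finset.sum_sub_distrib, ← Finset.sum_sub_distrib]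
    refine Finset.sum_le_sum fun i _ => ?_
    have := sub_le_truncatedSquare (threshold_nonneg n p t) (b i + z i)
    nlinarith [sq_nonneg (b i + 2 * z i)]
  rw [← Finset.mul_sum] at h1
  rw [← Finset.sum_div] at h4
  rw [← Finset.sum_add_sum_compl S, h3]
  linarith

theorem exists_score_constants :
    ∃ γ₀ c : ℝ, 0 < γ₀ ∧ 0 < c ∧ ∀ {n p : ℕ}, 2 ≤ n → 1 ≤ p →
      (Measure.pi (fun _ : Fin p => gaussianReal 0 1)).real
        {z | 0 < vectorScore n (fun t => γ₀ * rate n p t) z} ≤ ((n : ℝ) ^ 6)⁻¹ ∧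
      ∀ b : Fin p → ℝ, b ≠ 0 → c * rate n p {i | b i ≠ 0}.ncard ≤ ∑ i, b i ^ 2 →
        (Measure.pi (fun _ : Fin p => gaussianReal 0 1)).real
          {z | vectorScore n (fun t => γ₀ * rate n p t) (fun i => b i + z i) ≤ 0} ≤
          ((n : ℝ) ^ 6)⁻¹ := by
  classical
  obtain ⟨κ, M, hκ, hM, htail⟩ := exists_tail_bound
  obtain ⟨K, hK, hchi⟩ := exists_pi_sum_sq_ge_le
  obtain ⟨N, hN1, hN⟩ := exists_truncatedSecondMoment_le
  -- Chosen so that the tail bound is exactly `exp(-20 * tailExponent)`.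
  set g := (20 + M * κ ^ 2) / κ with hg
  have hκg : κ * g - M * κ ^ 2 = 20 := by rw [hg]; field_simp; ring
  have hMg : M * κ ≤ g := by rw [hg, le_div_iff₀ hκ]; nlinarith
  have hg0 : 0 < g := by positivity
  -- With `k ≤ 2 r(t)`, the chi-square exponent `k K - D r(t)/4` is at most `-10 r(t)`.
  set D := 8 * K + 40 with hD
  have hD0 : 0 < D := by positivity
  -- The `6` is the `2` of `vectorScore_pos_of_sparse` times the `3` of `rate_le_three_mul_rate`;
  -- the `320` makes `∑ b² / 32` at least `10 log n` in the dense case.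
  set c := 6 * (2 * g + D + 10 * N) + 320 with hc
  have hc0 : 0 < c := by positivity
  refine ⟨g, c, hg0, hc0, fun {n p} hn hp => ⟨?_, fun b hb hbc => ?_⟩⟩
  · refine pi_vectorScore_pos_le (fun t ht => ?_) hn hp
    have := htail hn hp (one_le_of_mem_sparsityGrid hp ht)
      (lt_or_log_le_of_mem_sparsityGrid hn hp ht) Finset.univ 1 (by simp) g hMg
    simpa [hκg] using this
  have hlg := log_pos_of_two_le hn
  set S : Finset (Fin p) := Finset.univ.filter fun i => b i ≠ 0 with hSdef
  have hcard : {i | b i ≠ 0}.ncard = S.card := by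
    rw [← Set.ncard_coe_finset]
    congr 1
    ext i
    simp [hSdef]
  have hS : ∀ i ∉ S, b i = 0 := fun i hi => by simpa [hSdef] using hi
  rw [hcard] at hbc
  set k := S.card with hk
  have hk1 : 1 ≤ k := by
    rw [hk, Nat.one_le_iff_ne_zero, Finset.card_ne_zero]
    obtain ⟨i, hi⟩ := Function.ne_iff.mp hb
    exact ⟨i, by simpa [hSdef] using hi⟩
  have hkp : k ≤ p := (Finset.card_le_univ S).trans_eq (by simp)
  have hrk := log_le_rate_of_le hn hp hkp
  rcases lt_or_ge (k : ℝ) √(p * Real.log n) with hkA | hkA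
  -- The largest grid point not exceeding `k`, hence at least `k/2`.
  · set t := 2 ^ Nat.log 2 k with ht
    have ht1 : 1 ≤ t := Nat.one_le_two_pow
    have htk : t ≤ k := Nat.pow_log_le_self 2 (by omega)
    have hkt : k ≤ 2 * t := by
      have := Nat.lt_pow_succ_log_self one_lt_two k
      rw [pow_succ] at this
      omega
    have htA : (t : ℝ) < √(p * Real.log n) := lt_of_le_of_lt (by exact_mod_cast htk) hkA
    have htgrid : t ∈ sparsityGrid n p := by
      refine Finset.mem_insert_of_mem (Finset.mem_image_of_mem _ (Finset.mem_range.mpr ?_))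
      exact Nat.lt_succ_of_le (Nat.log_mono_right (Nat.le_floor hkA.le))
    have hL := one_le_logFactor hn hp ht1 htA.le
    have hrt : (t : ℝ) * logFactor n p t ≤ rate n p t := rate_of_lt htA ▸ le_max_left _ _
    have hrtlg : Real.log n ≤ rate n p t := log_le_rate (Or.inl htA)
    have ht0 : (0 : ℝ) < t := by exact_mod_cast ht1
    have htr : (t : ℝ) ≤ rate n p t := le_trans (le_mul_of_one_le_right ht0.le hL) hrt
    have hkt' : (k : ℝ) ≤ 2 * t := by exact_mod_cast hkt
    have h3 := rate_le_three_mul_rate hn hp ht1 htk hkt hkA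
    have hν : (k : ℝ) * truncatedSecondMoment (threshold n p t) ≤ 10 * N * rate n p t := by
      have h4 := hN (threshold n p t) (threshold_nonneg n p t)
      rw [sq_threshold_of_le hn hp ht1 htA.le] at h4
      calc (k : ℝ) * truncatedSecondMoment (threshold n p t)
          ≤ 2 * t * (N * (5 * logFactor n p t)) :=
            mul_le_mul hkt' (h4.trans (by gcongr; linarith))
              ((sq_nonneg _).trans (sq_le_truncatedSecondMoment (threshold_nonneg n p t)))
              (by positivity)
        _ = 10 * N * (t * logFactor n p t) := by ring
        _ ≤ _ := by gcongr
    have hsub : {z : Fin p → ℝ | vectorScore n (fun t => g * rate n p t)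
        (fun i => b i + z i) ≤ 0} ⊆
        {z | g * rate n p t ≤ ∑ i ∈ Sᶜ, (-1) * truncatedSquare (threshold n p t) (z i)} ∪
        {z | D * rate n p t ≤ ∑ i ∈ S, z i ^ 2} := by
      intro z hz
      by_contra hcon
      simp only [Set.mem_union, Set.mem_ofPred_eq, not_or, not_le] at hcon
      refine absurd (vectorScore_pos_of_sparse htgrid hS hν ?_ hcon.1 hcon.2)
        (not_lt.mpr (show vectorScore n _ _ ≤ 0 from hz))
      refine le_trans ?_ hbc
      have h5 : 2 * (2 * g + D + 10 * N) * rate n p t ≤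
          2 * (2 * g + D + 10 * N) * (3 * rate n p k) := by gcongr
      rw [hc]
      linarith
    refine (measureReal_mono hsub).trans ((measureReal_union_le _ _).trans ?_)
    have e1 := htail hn hp ht1 (Or.inl htA) Sᶜ (-1) (by simp) g hMg
    have e2 := hchi S (D * rate n p t)
    have e3 : (k : ℝ) * K ≤ 2 * rate n p t * K := by gcongr; linarith
    refine (add_le_add e1 (e2.trans (Real.exp_le_exp.mpr
      (?_ : _ ≤ -(10 * rate n p t))))).trans (exp_add_exp_le_inv_pow hn ?_ ?_)
    · rw [hD]
      linarith
    · rw [hκg]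
      have := log_le_tailExponent hn hp ht1
      linarith
    · linarith
  · have hpA : √(p * Real.log n) < p := lt_of_le_of_ne
      (hkA.trans (by exact_mod_cast hkp)) (sqrt_mul_log_ne_natCast hn hp)
    have hreg := log_le_of_sqrt_mul_log_le hn hp hpA.le
    rw [rate_of_le hkA] at hbc hrk
    have hA0 := Real.sqrt_nonneg (p * Real.log n)
    have hsub : {z : Fin p → ℝ | vectorScore n (fun t => g * rate n p t)
        (fun i => b i + z i) ≤ 0} ⊆
        {z | g * rate n p p ≤ ∑ i, (-1) * truncatedSquare (threshold n p p) (z i)} ∪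
        {z | (∑ i, b i ^ 2) / 16 ≤ ∑ i, (-(b i / 4)) * z i} := by
      intro z hz
      by_contra hcon
      simp only [Set.mem_union, Set.mem_ofPred_eq, not_or, not_le] at hcon
      refine absurd (vectorScore_pos_of_dense hpA ?_ hcon.1 hcon.2)
        (not_lt.mpr (show vectorScore n _ _ ≤ 0 from hz))
      refine le_trans ?_ hbc
      gcongr
      rw [hc]
      linarith
    refine (measureReal_mono hsub).trans ((measureReal_union_le _ _).trans ?_)
    refine (add_le_add (htail hn hp hp (Or.inr hreg) Finset.univ (-1) (by simp) g hMg)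
      (pi_sum_mul_le_neg_le b)).trans (exp_add_exp_le_inv_pow hn ?_ ?_)
    · rw [hκg]
      have := log_le_tailExponent hn hp hp
      linarith
    · have h5 : 320 * Real.log n ≤ c * √(p * Real.log n) := by
        gcongr
        rw [hc]
        have : 0 ≤ 6 * (2 * g + D + 10 * N) := by positivity
        linarith
      linarith

end Scores

/-! ### The law of the CUSUM statistics -/

/-- The weight of time `t` in the CUSUM transformation. -/
noncomputable def cusumWeight (s e v t : ℕ) : ℝ :=
  if t ≤ v then √(((e : ℝ) - v) / (((e : ℝ) - s) * ((v : ℝ) - s)))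
  else -√(((v : ℝ) - s) / (((e : ℝ) - s) * ((e : ℝ) - v)))

theorem sum_Ioc_eq_sum_cusumWeight {s v e : ℕ} (hsv : s < v) (hve : v < e) (f : ℝ → ℝ → ℝ)
    (y : ℕ → ℝ) : ∑ t ∈ Finset.Ioc s e, f (cusumWeight s e v t) (y t) =
      ∑ t ∈ Finset.Ioc s v, f √(((e : ℝ) - v) / (((e : ℝ) - s) * ((v : ℝ) - s))) (y t) +
      ∑ t ∈ Finset.Ioc v e, f (-√(((v : ℝ) - s) / (((e : ℝ) - s) * ((e : ℝ) - v)))) (y t) := by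
  rw [← Finset.Ioc_union_Ioc_eq_Ioc hsv.le hve.le, Finset.sum_union]
  · congr 1
    · refine Finset.sum_congr rfl fun t ht => ?_
      rw [cusumWeight, if_pos (Finset.mem_Ioc.mp ht).2]
    · refine Finset.sum_congr rfl fun t ht => ?_
      rw [cusumWeight, if_neg (not_le.mpr (Finset.mem_Ioc.mp ht).1)]
  · rw [Finset.disjoint_left]
    intro t h1 h2
    simp only [Finset.mem_Ioc] at h1 h2
    omega

theorem cusum_eq_sum_cusumWeight {s v e : ℕ} (hsv : s < v) (hve : v < e) (y : ℕ → ℝ) :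
    cusum s e v y = ∑ t ∈ Finset.Ioc s e, cusumWeight s e v t * y t := by
  rw [sum_Ioc_eq_sum_cusumWeight hsv hve (fun w y => w * y), ← Finset.mul_sum, ← Finset.mul_sum,
    cusum]
  ring

theorem sum_sq_cusumWeight {s v e : ℕ} (hsv : s < v) (hve : v < e) :
    ∑ t ∈ Finset.Ioc s e, cusumWeight s e v t ^ 2 = 1 := by
  rw [sum_Ioc_eq_sum_cusumWeight hsv hve (fun w _ => w ^ 2) (fun _ => 0)]
  have h1 : (0 : ℝ) < v - s := by rw [sub_pos]; exact_mod_cast hsv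
  have h2 : (0 : ℝ) < e - v := by rw [sub_pos]; exact_mod_cast hve
  have h3 : (0 : ℝ) < e - s := by linarith
  rw [Finset.sum_const, Finset.sum_const, Nat.card_Ioc, Nat.card_Ioc, nsmul_eq_mul, nsmul_eq_mul,
    Nat.cast_sub hsv.le, Nat.cast_sub hve.le, neg_sq, Real.sq_sqrt (by positivity),
    Real.sq_sqrt (by positivity)]
  field_simp
  ring

theorem posSemidef_smul_one {p : ℕ} (σ : ℝ) :
    (σ ^ 2 • (1 : Matrix (Fin p) (Fin p) ℝ)).PosSemidef :=
  Matrix.PosSemidef.one.smul (sq_nonneg σ)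

theorem charFun_multivariateGaussian_smul_sub {p : ℕ} (m : EuclideanSpace ℝ (Fin p)) {σ : ℝ}
    (hσ : 0 < σ) (w : ℝ) (ξ : EuclideanSpace ℝ (Fin p)) :
    charFun ((multivariateGaussian m (σ ^ 2 • (1 : Matrix (Fin p) (Fin p) ℝ))).map
      fun x => w • σ⁻¹ • (x - m)) ξ = Complex.exp ((-(w ^ 2 * (‖ξ‖ ^ 2 / 2)) : ℝ)) := by
  have h1 : (fun x : EuclideanSpace ℝ (Fin p) => w • σ⁻¹ • (x - m)) =
      (fun x => (w * σ⁻¹) • x) ∘ fun x => x + (-m) := by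
    ext x
    simp [smul_smul, sub_eq_add_neg]
  rw [h1, ← Measure.map_map (by fun_prop) (by fun_prop), charFun_map_smul,
    charFun_map_add_const, charFun_multivariateGaussian (posSemidef_smul_one σ), ← Complex.exp_add]
  congr 1
  have h2 : ((w * σ⁻¹) • ξ).ofLp ⬝ᵥ (σ ^ 2 • (1 : Matrix (Fin p) (Fin p) ℝ)).mulVec
      ((w * σ⁻¹) • ξ).ofLp = w ^ 2 * ‖ξ‖ ^ 2 := by
    rw [Matrix.smul_mulVec, Matrix.one_mulVec, EuclideanSpace.real_norm_sq_eq]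
    simp only [dotProduct, WithLp.ofLp_smul, Pi.smul_apply, smul_eq_mul, Finset.mul_sum]
    refine Finset.sum_congr rfl fun i _ => ?_
    field_simp
  rw [h2]
  simp [real_inner_comm]
  ring

section Law

variable {Ω : Type*} [MeasurableSpace Ω] {P : Measure Ω} [IsProbabilityMeasure P] {n p : ℕ}
  {σ : ℝ} {μ : ℕ → EuclideanSpace ℝ (Fin p)} {X : ℕ → Ω → EuclideanSpace ℝ (Fin p)}

/-- The centred CUSUM vector is a sum of independent isotropic Gaussian vectors scaled by weights of
unit square sum, so its characteristic function is that of the standard Gaussian. -/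
theorem map_cusum_eq_pi (hσ : 0 < σ) (hX : iIndepFun (fun v : Set.Icc 1 n => X v) P)
    (hlaw : ∀ v ∈ Set.Icc 1 n, HasLaw (X v)
      (multivariateGaussian (μ v) (σ ^ 2 • (1 : Matrix (Fin p) (Fin p) ℝ))) P)
    {s v e : ℕ} (hsv : s < v) (hve : v < e) (hen : e ≤ n) :
    HasLaw (fun ω i => cusum s e v (fun u => (σ⁻¹ • X u ω) i) -
      cusum s e v (fun u => (σ⁻¹ • μ u) i)) (Measure.pi fun _ : Fin p => gaussianReal 0 1) P := by
  set Y : ℕ → Ω → EuclideanSpace ℝ (Fin p) :=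
    fun t ω => cusumWeight s e v t • σ⁻¹ • (X t ω - μ t) with hY
  have hmem : ∀ t ∈ Finset.Ioc s e, t ∈ Set.Icc 1 n := by
    intro t ht
    simp only [Finset.mem_Ioc, Set.mem_Icc] at ht ⊢
    omega
  have hmeasf : ∀ t : ℕ, Measurable fun x : EuclideanSpace ℝ (Fin p) =>
      cusumWeight s e v t • σ⁻¹ • (x - μ t) := fun t => by fun_prop
  have hYm : ∀ t ∈ Finset.Ioc s e, AEMeasurable (Y t) P := fun t ht =>
    (hmeasf t).comp_aemeasurable (hlaw t (hmem t ht)).aemeasurable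
  have hind : iIndepFun ((Finset.Ioc s e).restrict Y) P := by
    have h1 := hX.precomp (g := fun t : Finset.Ioc s e => (⟨t, hmem t t.2⟩ : Set.Icc 1 n))
      (fun a b h => Subtype.ext (by simpa using h))
    exact h1.comp (fun t => fun x => cusumWeight s e v t • σ⁻¹ • (x - μ t))
      fun t => hmeasf t
  have hmap : P.map (fun ω => ∑ t ∈ Finset.Ioc s e, Y t ω) =
      stdGaussian (EuclideanSpace ℝ (Fin p)) := by
    have : IsFiniteMeasure (P.map (fun ω => ∑ t ∈ Finset.Ioc s e, Y t ω)) := inferInstance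
    apply Measure.ext_of_charFun (E := EuclideanSpace ℝ (Fin p))
    ext ξ
    rw [hind.charFun_map_fun_finsetSum_eq_prod hYm, charFun_stdGaussian, Finset.prod_apply]
    have h2 : ∀ t ∈ Finset.Ioc s e, charFun (P.map (Y t)) ξ =
        Complex.exp ((-(cusumWeight s e v t ^ 2 * (‖ξ‖ ^ 2 / 2)) : ℝ)) := by
      intro t ht
      rw [← charFun_multivariateGaussian_smul_sub (μ t) hσ, ← (hlaw t (hmem t ht)).map_eq,
        AEMeasurable.map_map_of_aemeasurable (hmeasf t).aemeasurable
          (hlaw t (hmem t ht)).aemeasurable]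
      rfl
    rw [Finset.prod_congr rfl h2, ← Complex.exp_sum, ← Complex.ofReal_sum, Finset.sum_neg_distrib,
      ← Finset.sum_mul, sum_sq_cusumWeight hsv hve]
    push_cast
    ring_nf
  have hsumm : AEMeasurable (fun ω => ∑ t ∈ Finset.Ioc s e, Y t ω) P :=
    Finset.aemeasurable_fun_sum _ hYm
  have hZ : (fun ω i => cusum s e v (fun u => (σ⁻¹ • X u ω) i) -
      cusum s e v (fun u => (σ⁻¹ • μ u) i)) =
      (WithLp.ofLp : EuclideanSpace ℝ (Fin p) → Fin p → ℝ) ∘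
        fun ω => ∑ t ∈ Finset.Ioc s e, Y t ω := by
    ext ω i
    rw [cusum_eq_sum_cusumWeight hsv hve, cusum_eq_sum_cusumWeight hsv hve,
      ← Finset.sum_sub_distrib]
    simp only [Function.comp_apply, WithLp.ofLp_sum, Finset.sum_apply]
    refine Finset.sum_congr rfl fun t _ => ?_
    simp [hY]
    ring
  have hofLp : Measurable (WithLp.ofLp : EuclideanSpace ℝ (Fin p) → Fin p → ℝ) := by fun_prop
  rw [hZ]
  refine ⟨hofLp.comp_aemeasurable hsumm, ?_⟩
  rw [← AEMeasurable.map_map_of_aemeasurable hofLp.aemeasurable hsumm, hmap,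
    ← map_pi_eq_stdGaussian, Measure.map_map hofLp (by fun_prop)]
  exact Measure.map_id

/-- An inequality is enough for upper bounds, and it holds for every set `T`, measurable or not. -/
theorem real_mem_le_of_hasLaw {α : Type*} [MeasurableSpace α] {ν : Measure α} {Z : Ω → α}
    (hZ : HasLaw Z ν P) (T : Set α) : P.real {ω | Z ω ∈ T} ≤ ν.real T := by
  have := hZ.isProbabilityMeasure_iff.mp inferInstance
  have h := Measure.le_map_apply hZ.aemeasurable T
  rw [hZ.map_eq] at h
  exact ENNReal.toReal_mono (measure_ne_top _ _) h

end Law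

/-! ### Seeded intervals around a changepoint -/

theorem le_seedLength (α : ℝ) (m : ℕ) : m + 1 ≤ seedLength α m := by
  induction m with
  | zero => simp [seedLength]
  | succ m ih =>
    rw [seedLength]
    exact (Nat.succ_le_succ ih).trans (le_max_left _ _)

theorem seedLength_succ_le {α : ℝ} (hα : α ≤ 2) (m : ℕ) :
    seedLength α (m + 1) ≤ 2 * seedLength α m := by
  have h1 := one_le_seedLength α m
  rw [seedLength]
  refine max_le (by omega) (Nat.floor_le_of_le ?_)
  push_cast
  gcongr

/-- Take the first half-length reaching `x`. Consecutive half-lengths at most double since `α ≤ 2`,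
and the predecessor, if any, is below `x`. -/
theorem exists_seedLength_ge {α : ℝ} (hα : α ≤ 2) (x : ℝ) :
    ∃ m, x ≤ seedLength α m ∧ (seedLength α m = 1 ∨ (seedLength α m : ℝ) < 2 * x) := by
  have hex : ∃ m, x ≤ seedLength α m := by
    obtain ⟨m, hm⟩ := exists_nat_ge x
    exact ⟨m, hm.trans (by exact_mod_cast (Nat.le_succ m).trans (le_seedLength α m))⟩
  classical
  refine ⟨Nat.find hex, Nat.find_spec hex, ?_⟩
  rcases Nat.eq_zero_or_pos (Nat.find hex) with h | h
  · left
    rw [h, seedLength]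
  · right
    have h1 := Nat.find_min hex (Nat.sub_lt h one_pos)
    have h2 := seedLength_succ_le hα (Nat.find hex - 1)
    rw [Nat.sub_add_cancel h] at h2
    have h3 : (seedLength α (Nat.find hex) : ℝ) ≤ 2 * seedLength α (Nat.find hex - 1) := by
      exact_mod_cast h2
    linarith [not_le.mp h1]

theorem two_mul_seedShift_le {K : ℝ} (hK : 2 ≤ K) (l : ℕ) :
    seedShift K l = 1 ∨ 2 * seedShift K l ≤ l := by
  rw [seedShift]
  rcases le_total ⌊(l : ℝ) / K⌋₊ 1 with h | h
  · exact Or.inl (max_eq_left h)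
  · right
    rw [max_eq_right h]
    have h1 : (⌊(l : ℝ) / K⌋₊ : ℝ) ≤ l / K := Nat.floor_le (by positivity)
    have h2 : (l : ℝ) / K ≤ l / 2 := by gcongr
    have h3 : 2 * (⌊(l : ℝ) / K⌋₊ : ℝ) ≤ l := by linarith
    exact_mod_cast h3

/-- Round `η - l` down to a multiple of the shift. The midpoint then misses `η` by less than the
shift, which is `1` (no error) or at most `l/2` since `K ≥ 2`. -/
theorem exists_mem_seededIntervals {n : ℕ} {α K : ℝ} (hK : 2 ≤ K) (m : ℕ) {η : ℕ}
    (h1 : seedLength α m ≤ η) (h2 : η + seedLength α m ≤ n) :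
    ∃ s, (s, s + 2 * seedLength α m) ∈ seededIntervals n α K ∧ s + seedLength α m ≤ η ∧
      2 * (η - (s + seedLength α m)) ≤ seedLength α m := by
  set l := seedLength α m with hl
  set d := seedShift K l with hd
  have hd0 : 0 < d := lt_of_lt_of_le one_pos (le_max_left _ _)
  have hdiv := Nat.div_mul_le_self (η - l) d
  have hmod := Nat.lt_div_mul_add (a := η - l) hd0
  refine ⟨(η - l) / d * d, ⟨m, l, d, hl, hd, by omega, Or.inl ⟨(η - l) / d, ?_, rfl⟩⟩, ?_, ?_⟩
  · exact Nat.div_le_div_right (by omega)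
  · omega
  · rcases two_mul_seedShift_le hK l with h | h
    · rw [← hd] at h
      omega
    · rw [← hd] at h
      omega

theorem le_of_mem_seededIntervals {n : ℕ} {α K : ℝ} {I : ℕ × ℕ}
    (hI : I ∈ seededIntervals n α K) : I.2 ≤ n := by
  obtain ⟨m, l, d, -, -, hn, h⟩ := hI
  rcases h with ⟨i, hi, rfl⟩ | rfl
  · have h1 : i * d ≤ n - 2 * l := (Nat.mul_le_mul_right d hi).trans (Nat.div_mul_le_self _ _)
    simp only
    omega
  · rfl

/-! ### The recursion on detections -/

section Run

variable {p : ℕ} {variant : Variant} {n : ℕ} {x : ℕ → EuclideanSpace ℝ (Fin p)}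
  {M : Set (ℕ × ℕ)} {γ lam : ℕ → ℝ}

/-- Induction on the run with the invariant that the good interval `I j` of every changepoint
strictly inside the current segment lies in that segment. The map `f` sends a changepoint to its
estimate. The slack `3` in `hsep` allows adjacent changepoints with good intervals of width `2`. -/
theorem exists_image_of_run {T : Finset ℕ} {η : ℕ → ℕ} {I : ℕ → ℕ × ℕ}
    (hnull : ∀ A ∈ M, Detects variant n x γ A → ∃ j ∈ T, A.1 < η j ∧ η j < A.2)
    (hdet : ∀ j ∈ T, I j ∈ M ∧ Detects variant n x γ (I j))
    (hmem : ∀ j ∈ T, (I j).1 < η j ∧ η j < (I j).2)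
    (hinj : ∀ i ∈ T, ∀ j ∈ T, η i = η j → i = j)
    (hsep : ∀ i ∈ T, ∀ j ∈ T, η i < η j →
      ((I i).2 - (I i).1) + ((I j).2 - (I j).1) + η i ≤ η j + 3)
    {s e : ℕ} {B : Finset ℕ} (hrun : Run variant n x M γ lam s e B) :
    (∀ j ∈ T, s < η j → η j < e → s ≤ (I j).1 ∧ (I j).2 ≤ e) →
    ∃ f : ℕ → ℕ, B = (T.filter fun j => s < η j ∧ η j < e).image f ∧
      ∀ j ∈ T, s < η j → η j < e →
        f j + 2 ≤ η j + ((I j).2 - (I j).1) ∧ η j + 2 ≤ f j + ((I j).2 - (I j).1) := by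
  induction hrun with
  | short s e h =>
    intro _
    refine ⟨id, ?_, fun j _ h1 h2 => by omega⟩
    rw [Finset.filter_false_of_mem (fun j _ => by omega)]
    rfl
  | none s e h hempty =>
    intro hin
    have hno : ∀ j ∈ T, ¬(s < η j ∧ η j < e) := by
      rintro j hj ⟨h1, h2⟩
      obtain ⟨h3, h4⟩ := hin j hj h1 h2
      have : I j ∈ detections variant n x M γ s e := ⟨(hdet j hj).1, h3, h4, (hdet j hj).2⟩
      rw [hempty] at this
      exact this
    refine ⟨id, ?_, fun j hj h1 h2 => absurd ⟨h1, h2⟩ (hno j hj)⟩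
    rw [Finset.filter_false_of_mem hno]
    rfl
  | declare s e A v B₁ B₂ hse hA hv1 hv2 _ _ _ ih₁ ih₂ =>
    intro hin
    obtain ⟨⟨hAM, hsA, hAe, hAdet⟩, hmin⟩ := hA
    have hwidth : ∀ j ∈ T, s < η j → η j < e → A.2 - A.1 ≤ (I j).2 - (I j).1 := by
      intro j hj h1 h2
      obtain ⟨h3, h4⟩ := hin j hj h1 h2
      exact hmin _ ⟨(hdet j hj).1, h3, h4, (hdet j hj).2⟩
    obtain ⟨i, hi, hi1, hi2⟩ := hnull A hAM hAdet
    have hiw := hwidth i hi (by omega) (by omega)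
    -- The narrowest detection `A` is no wider than `I i` or `I j`, so `hsep` leaves no room for a
    -- second changepoint inside it.
    have hout : ∀ j ∈ T, s < η j → η j < e → j ≠ i → η j ≤ A.1 ∨ A.2 ≤ η j := by
      intro j hj h1 h2 hne
      have hjw := hwidth j hj h1 h2
      rcases lt_trichotomy (η j) (η i) with h | h | h
      · have := hsep j hj i hi h
        omega
      · exact absurd (hinj j hj i hi h) hne
      · have := hsep i hi j hj h
        omega
    -- The invariant passes on: `η i < A.2` and the width bound on `A`, combined with `hsep`, give
    -- `(I j).2 ≤ A.1 + 1`. This is where the overlap by one of the recursive segment with `A`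
    -- matters.
    obtain ⟨f₁, rfl, hf₁⟩ := ih₁ (by
      intro j hj h1 h2
      have h3 := hin j hj h1 (by omega)
      have h4 := hsep j hj i hi (by omega)
      have h5 := hmem j hj
      omega)
    obtain ⟨f₂, rfl, hf₂⟩ := ih₂ (by
      intro j hj h1 h2
      have h3 := hin j hj (by omega) h2
      have h4 := hsep i hi j hj (by omega)
      have h5 := hmem j hj
      omega)
    refine ⟨fun j => if j = i then v else if η j ≤ A.1 then f₁ j else f₂ j, ?_, ?_⟩
    · ext y
      simp only [Finset.mem_union, Finset.mem_singleton, Finset.mem_image, Finset.mem_filter]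
      constructor
      · rintro ((rfl | ⟨j, ⟨hj, h1, h2⟩, rfl⟩) | ⟨j, ⟨hj, h1, h2⟩, rfl⟩)
        · exact ⟨i, ⟨hi, by omega, by omega⟩, if_pos rfl⟩
        · have hji : j ≠ i := by rintro rfl; omega
          exact ⟨j, ⟨hj, h1, by omega⟩, by rw [if_neg hji, if_pos (by omega)]⟩
        · have hji : j ≠ i := by rintro rfl; omega
          exact ⟨j, ⟨hj, by omega, h2⟩, by rw [if_neg hji, if_neg (by omega)]⟩
      · rintro ⟨j, ⟨hj, h1, h2⟩, rfl⟩
        by_cases hji : j = i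
        · exact Or.inl (Or.inl (if_pos hji))
        · rw [if_neg hji]
          rcases hout j hj h1 h2 hji with h | h
          · rw [if_pos h]
            exact Or.inl (Or.inr ⟨j, ⟨hj, h1, by omega⟩, rfl⟩)
          · rw [if_neg (by omega)]
            exact Or.inr ⟨j, ⟨hj, by omega, h2⟩, rfl⟩
    · intro j hj h1 h2
      by_cases hji : j = i
      -- Both `v` and the changepoint are strictly inside `A`, so they differ by at most its width
      -- minus `2`.
      · subst hji
        simp only [if_true]
        omega
      · simp only [if_neg hji]
        rcases hout j hj h1 h2 hji with h | h
        · simp only [if_pos h]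
          exact hf₁ j hj h1 (by omega)
        · simp only [if_neg (by omega : ¬η j ≤ A.1)]
          exact hf₂ j hj (by omega) h2

end Run

/-! ### The mean sequence -/

namespace IsChangepointSequence

variable {p n J : ℕ} {μ : ℕ → EuclideanSpace ℝ (Fin p)} {η : ℕ → ℕ}

theorem lt_of_lt (h : IsChangepointSequence n J μ η) {i j : ℕ} (hij : i < j) (hj : j ≤ J + 1) :
    η i < η j := by
  induction j, hij using Nat.le_induction with
  | base => exact h.strict i (by omega)
  | succ j hj' ih => exact (ih (by omega)).trans (h.strict j (by omega))

theorem le_of_le (h : IsChangepointSequence n J μ η) {i j : ℕ} (hij : i ≤ j) (hj : j ≤ J + 1) :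
    η i ≤ η j := by
  rcases hij.eq_or_lt with rfl | hlt
  · rfl
  · exact (h.lt_of_lt hlt hj).le

theorem eq_of_forall_not_mem (h : IsChangepointSequence n J μ η) {s e : ℕ} (hen : e ≤ n)
    (hno : ∀ j, 1 ≤ j → j ≤ J → s < η j → η j < e → False) {u : ℕ} (hsu : s < u) (hue : u ≤ e) :
    μ u = μ e := by
  obtain ⟨k, rfl⟩ := Nat.exists_eq_add_of_le hue
  induction k with
  | zero => rfl
  | succ k ih =>
    have h1 : μ u = μ (u + k) :=
      ih (by omega) (fun j h1 h2 h3 h4 => hno j h1 h2 h3 (by omega)) (by omega)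
    rw [h1]
    by_contra hne
    obtain ⟨j, hj1, hjJ, hj⟩ := (h.change_iff (u + k) (by omega) (by omega)).mp hne
    exact hno j hj1 hjJ (by omega) (by omega)

theorem eq_of_mem_Ioc (h : IsChangepointSequence n J μ η) {j : ℕ} (hj : j ≤ J) {u : ℕ}
    (hu1 : η j < u) (hu2 : u ≤ η (j + 1)) : μ u = μ (η (j + 1)) := by
  refine h.eq_of_forall_not_mem (s := η j) ?_ ?_ hu1 hu2
  · rw [← h.last]
    exact h.le_of_le (by omega) le_rfl
  · intro i hi1 hiJ h1 h2
    rcases le_or_gt i j with hij | hij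
    · exact absurd (h.le_of_le hij (by omega)) (by omega)
    · exact absurd (h.le_of_le (i := j + 1) hij (by omega)) (by omega)

theorem meanChange_ne_zero (h : IsChangepointSequence n J μ η) {j : ℕ} (hj1 : 1 ≤ j)
    (hjJ : j ≤ J) : meanChange μ η j ≠ 0 := by
  have h0 := h.lt_of_lt (i := 0) (j := j) (by omega) (by omega)
  rw [h.zero] at h0
  have h1 := h.strict j hjJ
  have h2 := h.lt_of_lt (i := j) (j := J + 1) (by omega) le_rfl
  rw [h.last] at h2
  have h3 := (h.change_iff (η j) h0 h2).mpr ⟨j, hj1, hjJ, rfl⟩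
  rw [h.eq_of_mem_Ioc hjJ (Nat.lt_succ_self _) h1] at h3
  rw [meanChange]
  exact sub_ne_zero.mpr h3.symm

end IsChangepointSequence

/-! ### CUSUM statistics of constant and one-jump sequences. -/

theorem cusum_eq_zero_of_const {s v e : ℕ} (hsv : s < v) (hve : v < e) {y : ℕ → ℝ} {m : ℝ}
    (hy : ∀ u, s < u → u ≤ e → y u = m) : cusum s e v y = 0 := by
  have h1 : (0 : ℝ) < v - s := by rw [sub_pos]; exact_mod_cast hsv
  have h2 : (0 : ℝ) < e - v := by rw [sub_pos]; exact_mod_cast hve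
  have h3 : (0 : ℝ) < e - s := by linarith
  have e1 : ∑ t ∈ Finset.Ioc s v, y t = (v - s) * m := by
    rw [Finset.sum_congr rfl fun t ht => hy t (Finset.mem_Ioc.mp ht).1
      ((Finset.mem_Ioc.mp ht).2.trans hve.le)]
    rw [Finset.sum_const, Nat.card_Ioc, nsmul_eq_mul, Nat.cast_sub hsv.le]
  have e2 : ∑ t ∈ Finset.Ioc v e, y t = (e - v) * m := by
    rw [Finset.sum_congr rfl fun t ht => hy t (hsv.trans (Finset.mem_Ioc.mp ht).1)
      (Finset.mem_Ioc.mp ht).2]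
    rw [Finset.sum_const, Nat.card_Ioc, nsmul_eq_mul, Nat.cast_sub hve.le]
  have e3 : √(((e : ℝ) - v) / (((e : ℝ) - s) * ((v : ℝ) - s))) * (v - s) =
      √(((v : ℝ) - s) / (((e : ℝ) - s) * ((e : ℝ) - v))) * (e - v) := by
    have hsq : ∀ {a b : ℝ}, 0 ≤ a → 0 < b → √a * b = √(a * b ^ 2) := fun ha hb => by
      rw [Real.sqrt_mul ha, Real.sqrt_sq hb.le]
    rw [hsq (by positivity) h1, hsq (by positivity) h2]
    congr 1
    field_simp
  rw [cusum, e1, e2, ← mul_assoc, ← mul_assoc, e3, sub_self]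

/-- The CUSUM transformation at the midpoint of an interval of a sequence with one jump. -/
theorem cusum_midpoint_of_step {s l o : ℕ} (hl : 1 ≤ l) (ho : o ≤ l) {y : ℕ → ℝ} {a b : ℝ}
    (h1 : ∀ u, s < u → u ≤ s + l + o → y u = a)
    (h2 : ∀ u, s + l + o < u → u ≤ s + 2 * l → y u = b) :
    cusum s (s + 2 * l) (s + l) y = -((l - o) / √(2 * l)) * (b - a) := by
  have hl0 : (0 : ℝ) < l := by exact_mod_cast hl
  have e1 : ∑ t ∈ Finset.Ioc s (s + l), y t = l * a := by
    rw [Finset.sum_congr rfl fun t ht => h1 t (Finset.mem_Ioc.mp ht).1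
      ((Finset.mem_Ioc.mp ht).2.trans (by omega))]
    simp
  have e2 : ∑ t ∈ Finset.Ioc (s + l) (s + 2 * l), y t = o * a + (l - o) * b := by
    rw [← Finset.Ioc_union_Ioc_eq_Ioc (b := s + l + o) (by omega) (by omega), Finset.sum_union,
      Finset.sum_congr rfl fun t ht => h1 t
        ((Nat.le_add_right s l).trans_lt (Finset.mem_Ioc.mp ht).1) (Finset.mem_Ioc.mp ht).2,
      Finset.sum_congr rfl fun t ht => h2 t (Finset.mem_Ioc.mp ht).1 (Finset.mem_Ioc.mp ht).2]
    · rw [Finset.sum_const, Finset.sum_const, Nat.card_Ioc, Nat.card_Ioc, nsmul_eq_mul,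
        nsmul_eq_mul, show s + 2 * l - (s + l + o) = l - o by omega, Nat.cast_sub ho,
        Nat.add_sub_cancel_left]
    · rw [Finset.disjoint_left]
      intro t h3 h4
      simp only [Finset.mem_Ioc] at h3 h4
      omega
  have d1 : ((s + 2 * l : ℕ) : ℝ) - (s + l : ℕ) = l := by push_cast; ring
  have d2 : ((s + 2 * l : ℕ) : ℝ) - s = 2 * l := by push_cast; ring
  have d3 : ((s + l : ℕ) : ℝ) - s = l := by push_cast; ring
  have e3 : √((l : ℝ) / (2 * l * l)) = (√(2 * l))⁻¹ := by
    rw [← Real.sqrt_inv]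
    congr 1
    field_simp
  rw [cusum, e1, e2, d1, d2, d3, e3]
  ring

/-! ### Consistency of the procedure -/

theorem detects_of_midpoint {p n : ℕ} {x : ℕ → EuclideanSpace ℝ (Fin p)} {γ : ℕ → ℝ}
    (variant : Variant) {s l : ℕ} (hl : 1 ≤ l) (h : 0 < score n x γ s (s + 2 * l) (s + l)) :
    Detects variant n x γ (s, s + 2 * l) := by
  cases variant with
  | full => exact ⟨s + l, by simp only; omega, by simp only; omega, h⟩
  | midpoint =>
    have : (s + (s + 2 * l)) / 2 = s + l := by omega
    simpa only [Detects, this] using h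

theorem exists_score_pos_of_detects {p n : ℕ} {x : ℕ → EuclideanSpace ℝ (Fin p)} {γ : ℕ → ℝ}
    {variant : Variant} {A : ℕ × ℕ} (hA : A.1 + 2 ≤ A.2) (h : Detects variant n x γ A) :
    ∃ v, A.1 < v ∧ v < A.2 ∧ 0 < score n x γ A.1 A.2 v := by
  cases variant with
  | full => exact h
  | midpoint => exact ⟨(A.1 + A.2) / 2, by omega, by omega, h⟩

/-- If the score is nonpositive on intervals without changepoints, and if each changepoint is
detected at the midpoint of a short seeded interval, then the procedure estimates the number of
changepoints correctly, and their positions up to the widths of the seeded intervals. -/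
theorem IsOutput.exists_card_eq {p n J : ℕ} {μ x : ℕ → EuclideanSpace ℝ (Fin p)} {η : ℕ → ℕ}
    {variant : Variant} {α K : ℝ} {γ lam : ℕ → ℝ} {B : Finset ℕ} {s l : ℕ → ℕ}
    (hη : IsChangepointSequence n J μ η)
    (hl : ∀ j, 1 ≤ j → j ≤ J → 1 ≤ l j)
    (hM : ∀ j, 1 ≤ j → j ≤ J → (s j, s j + 2 * l j) ∈ seededIntervals n α K)
    (hmem : ∀ j, 1 ≤ j → j ≤ J → s j < η j ∧ η j < s j + 2 * l j)
    (hsep : ∀ j, 1 ≤ j → j ≤ J → η (j - 1) + 4 * l j ≤ η j + 3 ∧ η j + 4 * l j ≤ η (j + 1) + 3)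
    (hnull : ∀ a v e, a < v → v < e → e ≤ n → (∀ j, 1 ≤ j → j ≤ J → a < η j → η j < e → False) →
      score n x γ a e v ≤ 0)
    (hdet : ∀ j, 1 ≤ j → j ≤ J → 0 < score n x γ (s j) (s j + 2 * l j) (s j + l j))
    (hB : IsOutput variant n α K γ lam x B) :
    ∃ hJ : B.card = J, ∀ j : Fin J,
      B.orderEmbOfFin hJ j + 2 ≤ η (j + 1) + 2 * l (j + 1) ∧
      η (j + 1) + 2 ≤ B.orderEmbOfFin hJ j + 2 * l (j + 1) := by
  have hT : ∀ {j}, j ∈ Finset.Icc 1 J → 1 ≤ j ∧ j ≤ J := fun h => Finset.mem_Icc.mp h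
  have hlt : ∀ {i j}, i ≤ J → j ≤ J → η i < η j → i < j := by
    intro i j hi hj h
    by_contra hcon
    exact absurd (hη.le_of_le (not_lt.mp hcon) (by omega)) (by omega)
  -- The average of the right-hand bound of `hsep` at `i` and the left-hand bound at `j`.
  have hsep' : ∀ i ∈ Finset.Icc 1 J, ∀ j ∈ Finset.Icc 1 J, η i < η j →
      (s i + 2 * l i - s i) + (s j + 2 * l j - s j) + η i ≤ η j + 3 := by
    intro i hi j hj h
    obtain ⟨hi1, hiJ⟩ := hT hi
    obtain ⟨hj1, hjJ⟩ := hT hj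
    have hij := hlt hiJ hjJ h
    have h1 := (hsep i hi1 hiJ).2
    have h2 := (hsep j hj1 hjJ).1
    have h3 := hη.le_of_le (i := i + 1) (j := j) hij (by omega)
    have h4 := hη.le_of_le (i := i) (j := j - 1) (by omega) (by omega)
    omega
  obtain ⟨f, hfB, hf⟩ := exists_image_of_run (T := Finset.Icc 1 J) (η := η)
    (I := fun j => (s j, s j + 2 * l j)) (fun A hA hdetA => by
      obtain ⟨v, hv1, hv2, hpos⟩ := exists_score_pos_of_detects
        (width_of_mem_seededIntervals hA) hdetA
      by_contra hcon
      refine absurd (hnull A.1 v A.2 hv1 hv2 (le_of_mem_seededIntervals hA) ?_) (not_le.mpr hpos)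
      intro j h1 h2 h3 h4
      exact hcon ⟨j, Finset.mem_Icc.mpr ⟨h1, h2⟩, h3, h4⟩)
    (fun j hj => ⟨hM j (hT hj).1 (hT hj).2,
      detects_of_midpoint _ (hl j (hT hj).1 (hT hj).2) (hdet j (hT hj).1 (hT hj).2)⟩)
    (fun j hj => hmem j (hT hj).1 (hT hj).2)
    (fun i hi j hj h => by
      rcases lt_trichotomy i j with hij | hij | hij
      · exact absurd (hη.lt_of_lt hij (by have := (hT hj).2; omega)) (by omega)
      · exact hij
      · exact absurd (hη.lt_of_lt hij (by have := (hT hi).2; omega)) (by omega))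
    hsep' hB (fun j hj _ _ => ⟨Nat.zero_le _, le_of_mem_seededIntervals
      (hM j (hT hj).1 (hT hj).2)⟩)
  have hpos : ∀ j, 1 ≤ j → j ≤ J → 0 < η j ∧ η j < n := by
    intro j h1 h2
    have h3 := hη.lt_of_lt (i := 0) (j := j) h1 (by omega)
    have h4 := hη.lt_of_lt (i := j) (j := J + 1) (by omega) le_rfl
    rw [hη.zero] at h3
    rw [hη.last] at h4
    exact ⟨h3, h4⟩
  rw [Finset.filter_true_of_mem fun j hj => hpos j (hT hj).1 (hT hj).2] at hfB
  have hf' : ∀ j, 1 ≤ j → j ≤ J → f j + 2 ≤ η j + 2 * l j ∧ η j + 2 ≤ f j + 2 * l j := by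
    intro j h1 h2
    have := hf j (Finset.mem_Icc.mpr ⟨h1, h2⟩) (hpos j h1 h2).1 (hpos j h1 h2).2
    simp only at this
    omega
  -- The error bounds are smaller than the separation, so the estimates keep the order of the
  -- changepoints: they are distinct, and the sorted output matches them index by index.
  have hmono : ∀ i j, 1 ≤ i → i < j → j ≤ J → f i < f j := by
    intro i j h1 h2 h3
    have h4 := hη.lt_of_lt h2 (by omega)
    have h5 := hsep' i (Finset.mem_Icc.mpr ⟨h1, by omega⟩) j
      (Finset.mem_Icc.mpr ⟨by omega, h3⟩) h4
    have h6 := hf' i h1 (by omega)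
    have h7 := hf' j (by omega) h3
    omega
  have hcard : B.card = J := by
    rw [hfB, Finset.card_image_of_injOn, Nat.card_Icc, Nat.add_sub_cancel]
    intro i hi j hj h
    obtain ⟨hi1, hiJ⟩ := hT hi
    obtain ⟨hj1, hjJ⟩ := hT hj
    rcases lt_trichotomy i j with hij | hij | hij
    · exact absurd h (hmono i j hi1 hij hjJ).ne
    · exact hij
    · exact absurd h (hmono j i hj1 hij hiJ).ne'
  refine ⟨hcard, fun j => ?_⟩
  have horder := Finset.orderEmbOfFin_unique hcard (f := fun j : Fin J => f (j + 1))
    (fun j => by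
      rw [hfB]
      exact Finset.mem_image_of_mem f (Finset.mem_Icc.mpr ⟨by omega, by omega⟩))
    (fun i j hij => hmono _ _ (by omega) (by have := Fin.lt_def.mp hij; omega) (by omega))
  rw [← congrFun horder j]
  exact hf' (j + 1) (by omega) (by omega)

/-- A seeded interval around the `j`th changepoint whose half-length is of order `x`. -/
theorem IsChangepointSequence.exists_seededInterval {p n J : ℕ}
    {μ : ℕ → EuclideanSpace ℝ (Fin p)} {η : ℕ → ℕ} (hη : IsChangepointSequence n J μ η)
    {α K : ℝ} (hα : α ≤ 2) (hK : 2 ≤ K) {j : ℕ} (hj1 : 1 ≤ j) (hjJ : j ≤ J) {x : ℝ}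
    (hx : 16 * x ≤ spacing η j) :
    ∃ s l, 1 ≤ l ∧ (s, s + 2 * l) ∈ seededIntervals n α K ∧ s + l ≤ η j ∧
      2 * (η j - (s + l)) ≤ l ∧ η (j - 1) + 4 * l ≤ η j + 3 ∧ η j + 4 * l ≤ η (j + 1) + 3 ∧
      η (j - 1) ≤ s ∧ s + 2 * l ≤ η (j + 1) ∧ x ≤ l ∧ (l = 1 ∨ (l : ℝ) < 2 * x) := by
  obtain ⟨m, hm1, hm2⟩ := exists_seedLength_ge hα x
  have hl1 := one_le_seedLength α m
  set l := seedLength α m with hl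
  have h1 := hη.lt_of_lt (i := j - 1) (j := j) (by omega) (by omega)
  have h2 := hη.strict j hjJ
  have hn : η (j + 1) ≤ n := by
    rw [← hη.last]
    exact hη.le_of_le (by omega) le_rfl
  -- For `l = 1` the conclusions follow from the distinctness of changepoints alone, again thanks to
  -- the slack `3`.
  have h3 : l = 1 ∨ (η (j - 1) + 8 * l ≤ η j ∧ η j + 8 * l ≤ η (j + 1)) := by
    refine hm2.imp id fun h => ?_
    have h4 := hx.trans (min_le_left _ _)
    have h5 := hx.trans (min_le_right _ _)
    constructor
    · have : ((η (j - 1) : ℝ)) + 8 * l ≤ η j := by linarith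
      exact_mod_cast this
    · have : ((η j : ℝ)) + 8 * l ≤ η (j + 1) := by linarith
      exact_mod_cast this
  obtain ⟨s, hs1, hs2, hs3⟩ := exists_mem_seededIntervals (n := n) (α := α) hK m (η := η j)
    (by omega) (by omega)
  rw [← hl] at hs1 hs2 hs3
  exact ⟨s, l, hl1, hs1, hs2, hs3, by omega, by omega, by omega, by omega, hm1, hm2⟩

theorem IsChangepointSequence.cusum_midpoint {p n J : ℕ}
    {μ : ℕ → EuclideanSpace ℝ (Fin p)} {η : ℕ → ℕ} (hη : IsChangepointSequence n J μ η)
    {j s l : ℕ} (hj1 : 1 ≤ j) (hjJ : j ≤ J) (hl : 1 ≤ l) (h1 : s + l ≤ η j)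
    (h2 : 2 * (η j - (s + l)) ≤ l) (h3 : η (j - 1) ≤ s) (h4 : s + 2 * l ≤ η (j + 1)) (σ : ℝ)
    (i : Fin p) : cusum s (s + 2 * l) (s + l) (fun u => (σ⁻¹ • μ u) i) =
      -(((l - (η j - (s + l) : ℕ)) / √(2 * l)) * σ⁻¹) * meanChange μ η j i := by
  have ho : s + l + (η j - (s + l)) = η j := by omega
  rw [cusum_midpoint_of_step hl (o := η j - (s + l)) (a := σ⁻¹ * μ (η j) i)
    (b := σ⁻¹ * μ (η (j + 1)) i) (by omega)]
  · simp only [meanChange, PiLp.sub_apply]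
    ring
  · intro u hu1 hu2
    have := hη.eq_of_mem_Ioc (j := j - 1) (u := u) (by omega) (by omega)
      (by rw [Nat.sub_add_cancel hj1]; omega)
    rw [Nat.sub_add_cancel hj1] at this
    simp [this]
  · intro u hu1 hu2
    have := hη.eq_of_mem_Ioc (u := u) hjJ (by omega) (by omega)
    simp [this]

theorem score_eq_vectorScore_add {p : ℕ} (n : ℕ) (x m : ℕ → EuclideanSpace ℝ (Fin p))
    (γ : ℕ → ℝ) (s e v : ℕ) : score n x γ s e v = vectorScore n γ fun i =>
      cusum s e v (fun u => m u i) +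
        (cusum s e v (fun u => x u i) - cusum s e v (fun u => m u i)) := by
  rw [score_eq_vectorScore]
  congr 1
  ext i
  ring

/-! ### Transfer to the Gaussian model and the union bound. -/

section Probability

variable {Ω : Type*} [MeasurableSpace Ω] {P : Measure Ω} [IsProbabilityMeasure P] {n p J : ℕ}
  {σ : ℝ} {μ : ℕ → EuclideanSpace ℝ (Fin p)} {X : ℕ → Ω → EuclideanSpace ℝ (Fin p)} {η : ℕ → ℕ}

theorem IsChangepointSequence.real_score_pos_le (hη : IsChangepointSequence n J μ η)
    (hσ : 0 < σ) (hX : iIndepFun (fun v : Set.Icc 1 n => X v) P)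
    (hlaw : ∀ v ∈ Set.Icc 1 n, HasLaw (X v)
      (multivariateGaussian (μ v) (σ ^ 2 • (1 : Matrix (Fin p) (Fin p) ℝ))) P)
    {s v e : ℕ} (hsv : s < v) (hve : v < e) (hen : e ≤ n)
    (hno : ∀ j, 1 ≤ j → j ≤ J → s < η j → η j < e → False) (γ : ℕ → ℝ) :
    P.real {ω | 0 < score n (fun u => σ⁻¹ • X u ω) γ s e v} ≤
      (Measure.pi fun _ : Fin p => gaussianReal 0 1).real {z | 0 < vectorScore n γ z} := by
  refine le_trans (le_of_eq ?_) (real_mem_le_of_hasLaw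
    (map_cusum_eq_pi hσ hX hlaw hsv hve hen) {z | 0 < vectorScore n γ z})
  congr 1
  ext ω
  have h0 : ∀ i, cusum s e v (fun u => (σ⁻¹ • μ u) i) = 0 := fun i =>
    cusum_eq_zero_of_const hsv hve (m := (σ⁻¹ • μ e) i) fun u h1 h2 => by
      rw [hη.eq_of_forall_not_mem hen hno h1 h2]
  simp only [Set.mem_ofPred_eq, h0, sub_zero]
  rfl

theorem real_score_nonpos_le (hσ : 0 < σ) (hX : iIndepFun (fun v : Set.Icc 1 n => X v) P)
    (hlaw : ∀ v ∈ Set.Icc 1 n, HasLaw (X v)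
      (multivariateGaussian (μ v) (σ ^ 2 • (1 : Matrix (Fin p) (Fin p) ℝ))) P)
    {s v e : ℕ} (hsv : s < v) (hve : v < e) (hen : e ≤ n) (γ : ℕ → ℝ) :
    P.real {ω | score n (fun u => σ⁻¹ • X u ω) γ s e v ≤ 0} ≤
      (Measure.pi fun _ : Fin p => gaussianReal 0 1).real
        {z | vectorScore n γ (fun i => cusum s e v (fun u => (σ⁻¹ • μ u) i) + z i) ≤ 0} := by
  refine le_trans (le_of_eq ?_) (real_mem_le_of_hasLaw
    (map_cusum_eq_pi hσ hX hlaw hsv hve hen) {z | vectorScore n γ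
      (fun i => cusum s e v (fun u => (σ⁻¹ • μ u) i) + z i) ≤ 0})
  congr 1
  ext ω
  simp only [Set.mem_ofPred_eq]
  rw [score_eq_vectorScore_add n _ (fun u => σ⁻¹ • μ u)]

/-- The union bound over all intervals and positions, and over all changepoints. -/
theorem one_sub_inv_lt_real_of_subset (hn : 2 ≤ n) (hJn : J ≤ n) {T : Set Ω}
    {F : ℕ × ℕ × ℕ → Set Ω} {G : ℕ → Set Ω} (hF : ∀ q, P.real (F q) ≤ ((n : ℝ) ^ 6)⁻¹)
    (hG : ∀ j ∈ Finset.Icc 1 J, P.real (G j) ≤ ((n : ℝ) ^ 6)⁻¹)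
    (hT : ∀ ω, (∀ s v e, s < v → v < e → e ≤ n → ω ∉ F (s, v, e)) →
      (∀ j, 1 ≤ j → j ≤ J → ω ∉ G j) → ω ∈ T) : 1 - 1 / (n : ℝ) < P.real T := by
  set Q := Finset.range n ×ˢ Finset.range n ×ˢ Finset.Icc 1 n with hQ
  have hQcard : (Q.card : ℝ) = n ^ 3 := by
    rw [hQ]
    simp only [Finset.card_product, Finset.card_range, Nat.card_Icc, Nat.add_sub_cancel]
    push_cast
    ring
  -- Covering the whole space and using subadditivity bounds the probability of `T` from below
  -- without measurability of `T`.
  have hcover : (Set.univ : Set Ω) ⊆ T ∪ ((⋃ q ∈ Q, F q) ∪ ⋃ j ∈ Finset.Icc 1 J, G j) := by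
    intro ω _
    by_contra hcon
    simp only [Set.mem_union, Set.mem_iUnion, not_or, not_exists] at hcon
    refine hcon.1 (hT ω (fun s v e h1 h2 h3 => hcon.2.1 (s, v, e) ?_)
      fun j h1 h2 => hcon.2.2 j (Finset.mem_Icc.mpr ⟨h1, h2⟩))
    simp only [hQ, Finset.mem_product, Finset.mem_range, Finset.mem_Icc]
    omega
  have h1 : (1 : ℝ) ≤ P.real T + (P.real (⋃ q ∈ Q, F q) +
      P.real (⋃ j ∈ Finset.Icc 1 J, G j)) := by
    calc (1 : ℝ) = P.real Set.univ := by simp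
      _ ≤ _ := measureReal_mono hcover
      _ ≤ _ := measureReal_union_le _ _
      _ ≤ _ := by gcongr; exact measureReal_union_le _ _
  have h2 : P.real (⋃ q ∈ Q, F q) ≤ n ^ 3 * ((n : ℝ) ^ 6)⁻¹ := by
    refine (measureReal_biUnion_finset_le _ _).trans
      ((Finset.sum_le_card_nsmul _ _ _ fun q _ => hF q).trans_eq ?_)
    rw [nsmul_eq_mul, hQcard]
  have h3 : P.real (⋃ j ∈ Finset.Icc 1 J, G j) ≤ n * ((n : ℝ) ^ 6)⁻¹ := by
    refine (measureReal_biUnion_finset_le _ _).trans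
      ((Finset.sum_le_card_nsmul _ _ _ hG).trans ?_)
    rw [nsmul_eq_mul, Nat.card_Icc, Nat.add_sub_cancel]
    have : (J : ℝ) ≤ n := by exact_mod_cast hJn
    gcongr
  have hn2 : (2 : ℝ) ≤ n := by exact_mod_cast hn
  have h4 : n ^ 3 * ((n : ℝ) ^ 6)⁻¹ + n * ((n : ℝ) ^ 6)⁻¹ < 1 / n := by
    rw [← add_mul, ← div_eq_mul_inv, div_lt_div_iff₀ (by positivity) (by positivity)]
    have h5 : (n : ℝ) ^ 2 + 1 < n ^ 4 := by nlinarith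
    have h6 : 0 < (n : ℝ) ^ 2 := by positivity
    nlinarith
  linarith

end Probability

end ESAC

/-! ### Choice of constants and conclusion. -/

theorem theorem2 :
    ∃ γ₀ : ℝ, 0 < γ₀ ∧ ∃ C₀ C₁ : ℝ, 0 < C₀ ∧ 0 < C₁ ∧
      ∀ (variant : ESAC.Variant) (n p : ℕ), 2 ≤ n → 1 ≤ p →
      ∀ (σ : ℝ), 0 < σ →
      ∀ (μ : ℕ → EuclideanSpace ℝ (Fin p)) (J : ℕ) (η : ℕ → ℕ),
        ESAC.IsChangepointSequence n J μ η →
      ∀ (Ω : Type*) [MeasurableSpace Ω] (P : MeasureTheory.Measure Ω)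
        [MeasureTheory.IsProbabilityMeasure P] (X : ℕ → Ω → EuclideanSpace ℝ (Fin p)),
        ProbabilityTheory.iIndepFun (fun (v : Set.Icc 1 n) => X v) P →
        (∀ v ∈ Set.Icc 1 n, ProbabilityTheory.HasLaw (X v)
          (ProbabilityTheory.multivariateGaussian (μ v) (σ ^ 2 • (1 : Matrix (Fin p) (Fin p) ℝ)))
          P) →
      ∀ (α K : ℝ), 1 < α → α ≤ 2 → 2 ≤ K →
      ∀ (lam : ℕ → ℝ) (B : Ω → Finset ℕ),
        (∀ ω, ESAC.IsOutput variant n α K (fun t => γ₀ * ESAC.rate n p t) lam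
          (fun v => σ⁻¹ • X v ω) (B ω)) →
        (∀ j, 1 ≤ j → j ≤ J →
          C₀ * ESAC.rate n p (ESAC.sparsity (ESAC.meanChange μ η j)) ≤
            ‖ESAC.meanChange μ η j‖ ^ 2 * ESAC.spacing η j / σ ^ 2) →
        1 - 1 / (n : ℝ) < P.real {ω | ∃ hJ : (B ω).card = J, ∀ j : Fin J,
          |(((B ω).orderEmbOfFin hJ j : ℕ) : ℝ) - (η (j + 1) : ℝ)| ≤
            C₁ * (σ ^ 2 / ‖ESAC.meanChange μ η (j + 1)‖ ^ 2) *
              ESAC.rate n p (ESAC.sparsity (ESAC.meanChange μ η (j + 1)))} := by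
  classical
  obtain ⟨γ₀, c, hγ, hc, hscore⟩ := ESAC.exists_score_constants
  -- Half-lengths start from `x = 8 c σ² r(k) / φ²`, the `8` undoing the signal loss in `ha2`. The
  -- spacing condition `16 x ≤ Δ` gives `128 c`; the error `2 l - 2` with `l < 2 x` gives `32 c`.
  refine ⟨γ₀, hγ, 128 * c, 32 * c, by positivity, by positivity, ?_⟩
  intro variant n p hn hp σ hσ μ J η hη Ω _ P _ X hX hlaw α K _ hα hK lam B hB hsnr
  obtain ⟨hnull, hpower⟩ := hscore hn hp
  have hφ : ∀ j, 1 ≤ j → j ≤ J → 0 < ‖ESAC.meanChange μ η j‖ := fun j h1 h2 =>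
    norm_pos_iff.mpr (hη.meanChange_ne_zero h1 h2)
  have hseed : ∀ j, 1 ≤ j → j ≤ J → 16 * (8 * c * (σ ^ 2 / ‖ESAC.meanChange μ η j‖ ^ 2) *
      ESAC.rate n p (ESAC.sparsity (ESAC.meanChange μ η j))) ≤ ESAC.spacing η j := by
    intro j h1 h2
    have h3 := hsnr j h1 h2
    have h4 := hφ j h1 h2
    rw [le_div_iff₀ (by positivity)] at h3
    have h5 : 16 * (8 * c * (σ ^ 2 / ‖ESAC.meanChange μ η j‖ ^ 2) *
        ESAC.rate n p (ESAC.sparsity (ESAC.meanChange μ η j))) =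
        (128 * c * ESAC.rate n p (ESAC.sparsity (ESAC.meanChange μ η j)) * σ ^ 2) /
          ‖ESAC.meanChange μ η j‖ ^ 2 := by
      field_simp
      ring
    rw [h5, div_le_iff₀ (by positivity)]
    linarith
  have hex := fun j h1 h2 => hη.exists_seededInterval (K := K) hα hK (j := j) h1 h2 (hseed j h1 h2)
  choose! s l hl hM hs1 hs2 hsep1 hsep2 hs3 hs4 hx1 hx2 using hex
  have hηn : ∀ j, j ≤ J → η (j + 1) ≤ n := fun j h => by
    rw [← hη.last]
    exact hη.le_of_le (by omega) le_rfl
  have hJn : J ≤ n := by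
    have : ∀ j, j ≤ J + 1 → j ≤ η j := by
      intro j
      induction j with
      | zero => intro _; exact Nat.zero_le _
      | succ j ih =>
        intro h
        have h1 := ih (by omega)
        have h2 := hη.strict j (by omega)
        omega
    have h1 := this (J + 1) le_rfl
    rw [hη.last] at h1
    omega
  set γ : ℕ → ℝ := fun t => γ₀ * ESAC.rate n p t with hγdef
  refine ESAC.one_sub_inv_lt_real_of_subset hn hJn
    -- The deterministic conditions are placed inside the event, which is then empty for
    -- inadmissible triples, so that one bound serves for all of them.
    (F := fun q => {ω | q.1 < q.2.1 ∧ q.2.1 < q.2.2 ∧ q.2.2 ≤ n ∧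
      (∀ j, 1 ≤ j → j ≤ J → q.1 < η j → η j < q.2.2 → False) ∧
      0 < ESAC.score n (fun u => σ⁻¹ • X u ω) γ q.1 q.2.2 q.2.1})
    (G := fun j => {ω | ESAC.score n (fun u => σ⁻¹ • X u ω) γ (s j) (s j + 2 * l j)
      (s j + l j) ≤ 0}) ?_ ?_ ?_
  · rintro ⟨a, v, e⟩
    by_cases hq : a < v ∧ v < e ∧ e ≤ n ∧ (∀ j, 1 ≤ j → j ≤ J → a < η j → η j < e → False)
    · obtain ⟨h1, h2, h3, h4⟩ := hq
      refine le_trans (MeasureTheory.measureReal_mono ?_)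
        ((hη.real_score_pos_le hσ hX hlaw h1 h2 h3 h4 γ).trans hnull)
      rintro ω ⟨-, -, -, -, h⟩
      exact h
    · refine le_trans (le_of_eq ?_) (by positivity : (0 : ℝ) ≤ ((n : ℝ) ^ 6)⁻¹)
      rw [show {ω | a < v ∧ v < e ∧ e ≤ n ∧ (∀ j, 1 ≤ j → j ≤ J → a < η j → η j < e → False) ∧
        0 < ESAC.score n (fun u => σ⁻¹ • X u ω) γ a e v} = ∅ from
        Set.eq_empty_of_forall_notMem fun ω ⟨h1, h2, h3, h4, _⟩ => hq ⟨h1, h2, h3, h4⟩]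
      simp
  · intro j hj
    obtain ⟨h1, h2⟩ := Finset.mem_Icc.mp hj
    have hlj := hl j h1 h2
    have hs1j := hs1 j h1 h2
    have hs2j := hs2 j h1 h2
    have hl0 : (0 : ℝ) < l j := by exact_mod_cast hlj
    have hθ := hφ j h1 h2
    have ho : 2 * ((η j - (s j + l j) : ℕ) : ℝ) ≤ l j := by exact_mod_cast hs2j
    have hb := hη.cusum_midpoint h1 h2 hlj hs1j hs2j (hs3 j h1 h2) (hs4 j h1 h2) σ
    set a : ℝ := -(((l j - (η j - (s j + l j) : ℕ)) / √(2 * l j)) * σ⁻¹) with ha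
    have ha0 : a ≠ 0 := by
      rw [ha, neg_ne_zero]
      have h3 : (0 : ℝ) < l j - (η j - (s j + l j) : ℕ) := by linarith
      positivity
    -- The midpoint is off by at most `l/2`, so `l - o ≥ l/2` and `(l - o)² / (2 l) ≥ l/8`.
    have ha2 : (l j : ℝ) / 8 / σ ^ 2 ≤ a ^ 2 := by
      rw [ha, neg_sq, mul_pow, div_pow, Real.sq_sqrt (by positivity), inv_pow, ← div_eq_mul_inv]
      refine div_le_div_of_nonneg_right ?_ (sq_nonneg σ)
      rw [div_le_div_iff₀ (by norm_num) (by positivity)]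
      nlinarith
    refine (ESAC.real_score_nonpos_le hσ hX hlaw (by omega) (by omega)
      ((hs4 j h1 h2).trans (hηn j h2)) γ).trans ?_
    simp only [hb]
    refine hpower (fun i => a * ESAC.meanChange μ η j i) ?_ ?_
    · intro h0
      refine hη.meanChange_ne_zero h1 h2 ?_
      ext i
      have := congrFun h0 i
      simpa [ha0] using this
    · have hcard : {i | a * ESAC.meanChange μ η j i ≠ 0}.ncard =
          ESAC.sparsity (ESAC.meanChange μ η j) := by
        simp [ESAC.sparsity, ha0]
      simp only [mul_pow, ← Finset.mul_sum, ← EuclideanSpace.real_norm_sq_eq]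
      rw [hcard]
      have hx := hx1 j h1 h2
      calc c * ESAC.rate n p (ESAC.sparsity (ESAC.meanChange μ η j))
          = (8 * c * (σ ^ 2 / ‖ESAC.meanChange μ η j‖ ^ 2) *
            ESAC.rate n p (ESAC.sparsity (ESAC.meanChange μ η j))) / 8 / σ ^ 2 *
            ‖ESAC.meanChange μ η j‖ ^ 2 := by field_simp
        _ ≤ l j / 8 / σ ^ 2 * ‖ESAC.meanChange μ η j‖ ^ 2 := by gcongr
        _ ≤ _ := by gcongr
  · intro ω hF hG
    obtain ⟨hJ, hloc⟩ := ESAC.IsOutput.exists_card_eq hη hl hM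
      (fun j h1 h2 => by
        have h3 := hl j h1 h2
        have h4 := hs1 j h1 h2
        have h5 := hs2 j h1 h2
        omega)
      (fun j h1 h2 => ⟨hsep1 j h1 h2, hsep2 j h1 h2⟩)
      (fun a v e h1 h2 h3 h4 => by
        by_contra hcon
        exact hF a v e h1 h2 h3 ⟨h1, h2, h3, h4, not_le.mp hcon⟩)
      (fun j h1 h2 => not_le.mp (hG j h1 h2)) (hB ω)
    refine ⟨hJ, fun j => ?_⟩
    obtain ⟨h1, h2⟩ := hloc j
    have hj2 : (j : ℕ) + 1 ≤ J := j.2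
    have h1' : (((B ω).orderEmbOfFin hJ j : ℕ) : ℝ) + 2 ≤ η (j + 1) + 2 * l (j + 1) := by
      exact_mod_cast h1
    have h2' : (η (j + 1) : ℝ) + 2 ≤ ((B ω).orderEmbOfFin hJ j : ℕ) + 2 * l (j + 1) := by
      exact_mod_cast h2
    have h3 : |(((B ω).orderEmbOfFin hJ j : ℕ) : ℝ) - (η (j + 1) : ℝ)| ≤ 2 * l (j + 1) - 2 := by
      rw [abs_le]
      constructor <;> linarith
    refine h3.trans ?_
    have hθ := hφ (j + 1) (by omega) hj2
    -- If `l = 1`, the error bound `2 l - 2` is zero, so the minimal half-length needs no comparison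
    -- with the rate.
    rcases hx2 (j + 1) (by omega) hj2 with h4 | h4
    · rw [h4]
      have hk : ESAC.sparsity (ESAC.meanChange μ η (j + 1)) ≤ p := by
        have := Set.ncard_le_card {i | ESAC.meanChange μ η (j + 1) i ≠ 0}
        simpa [ESAC.sparsity] using this
      have h5 : 0 ≤ ESAC.rate n p (ESAC.sparsity (ESAC.meanChange μ η (j + 1))) :=
        (ESAC.log_pos_of_two_le hn).le.trans (ESAC.log_le_rate_of_le hn hp hk)
      have : 0 ≤ 32 * c * (σ ^ 2 / ‖ESAC.meanChange μ η (j + 1)‖ ^ 2) *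
          ESAC.rate n p (ESAC.sparsity (ESAC.meanChange μ η (j + 1))) := by positivity
      push_cast
      linarith
    · linarith
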